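/- Let $m\ge 2$ and $p\ge 1$ be integers. Let $B_\ell$ be the set of cyclically reduced words of length at most $\ell$ in $x_1^{\pm1},\dots,x_m^{\pm1}$. Let $d\in\{-\infty\}\cup[0,1]$, and let $(G_\ell(m,d))$ be a sequence of random groups at density $d$, that is, $G_\ell(m,d)=\langle x_1,\dots,x_m\mid R_\ell\rangle$, where $R_\ell$ is a random subset of $B_\ell$ whose law is invariant under all permutations of the set $B_\ell$, and where the random variables $\log_{|B_\ell|}|R_\ell|$ (with $\log 0=-\infty$) converge in probability to $d$ as $\ell\to\infty$. A property holds a.a.s. if its probability tends to $1$ as $\ell\to\infty$. A piece with respect to $R_\ell$ is a common initial segment of two distinct elements of the symmetrized set of relators (all cyclic permutations of elements of $R_\ell$ and of their inverses). The presentation satisfies the Ollivier–Wise condition $B(2p)$ if half of a relator is never a product of at most $p$ pieces: every cyclic subword $s$ of a relator or inverse relator $r$ that is a product of at most $p$ pieces satisfies $|s|<\frac12|r|$. The condition with $|s|\le\frac12|r|$ in place of $|s|<\frac12|r|$ is called the non-strict form of $B(2p)$. Then, for both forms: (i) If $d<\frac1{2p+2}$, then a.a.s. $G_\ell(m,d)$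 satisfies $B(2p)$. (ii) If $d>\frac1{2p+2}$, then a.a.s. $G_\ell(m,d)$ does not satisfy $B(2p)$. -/

import Mathlib

open Filter Topology MeasureTheory

/-- Words in the letters `x₁^±, …, x_m^±`; the letter `(i, true)` is `x_i`, and `(i, false)` is its
inverse. -/
abbrev GWord (m : ℕ) : Type := List (Fin m × Bool)

/-- The set `B_ℓ` of cyclically reduced words of length at most `ℓ` in `m` generators. -/
def relatorBall (m ℓ : ℕ) : Set (GWord m) :=
  {w | FreeGroup.IsCyclicallyReduced w ∧ w.length ≤ ℓ}

instance relatorBall_finite (m ℓ : ℕ) : Finite (relatorBall m ℓ) :=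
  ((List.finite_length_le (Fin m × Bool) ℓ).subset fun _ h => h.2).to_subtype

/-- The density `log_{|E|} |A|` of a subset `A` of a finite set `E`, with `log 0 = -∞`. -/
noncomputable def subsetDensity {E : Type*} (A : Set E) : EReal :=
  open Classical in
  if A = ∅ then ⊥ else ((Real.logb (Nat.card E) A.ncard : ℝ) : EReal)

section RandomSubsets

universe u

variable {Ω : ℕ → Type u} [∀ ℓ, MeasurableSpace (Ω ℓ)]

/-- `R` is a random subset of the finite set `E`: the events `R = A` are measurable. -/
def IsRandomSubset {Ω' E : Type*} [MeasurableSpace Ω'] (R : Ω' → Set E) : Prop :=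
  ∀ A : Set E, MeasurableSet {ω | R ω = A}

/-- The law of the random subset `R` of `E` is invariant under all permutations of `E`. -/
def IsPermutationInvariant {Ω' E : Type*} [MeasurableSpace Ω'] (P : Measure Ω')
    (R : Ω' → Set E) : Prop :=
  ∀ (σ : Equiv.Perm E) (A : Set E), P {ω | R ω = σ '' A} = P {ω | R ω = A}

/-- The sequence of random subsets `R ℓ` of `E ℓ` is densable with density `d`, an element of
`{-∞} ∪ [0, 1]`: the densities of the `R ℓ` converge in probability to the constant `d`. -/
def IsDensable {E : ℕ → Type*} (P : ∀ ℓ, Measure (Ω ℓ)) (R : ∀ ℓ, Ω ℓ → Set (E ℓ))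
    (d : EReal) : Prop :=
  (d = ⊥ ∨ (0 ≤ d ∧ d ≤ 1)) ∧
    ∀ U ∈ 𝓝 d, Tendsto (fun ℓ => P ℓ {ω | subsetDensity (R ℓ ω) ∉ U}) atTop (𝓝 0)

/-- The event `Q ℓ` holds asymptotically almost surely. -/
def AAS (P : ∀ ℓ, Measure (Ω ℓ)) (Q : ∀ ℓ, Ω ℓ → Prop) : Prop :=
  Tendsto (fun ℓ => P ℓ {ω | Q ℓ ω}) atTop (𝓝 1)

/-- `R` is the sequence of random sets of relators of a sequence of random groups
`G_ℓ(m, d) = ⟨x₁, …, x_m | R_ℓ⟩` at density `d`: a densable sequence, with density `d`, of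
permutation invariant random subsets of the sets `B_ℓ`. -/
structure IsRandomGroupSequence (m : ℕ) (d : EReal) (P : ∀ ℓ, Measure (Ω ℓ))
    (R : ∀ ℓ, Ω ℓ → Set (relatorBall m ℓ)) : Prop where
  isRandomSubset : ∀ ℓ, IsRandomSubset (R ℓ)
  permutationInvariant : ∀ ℓ, IsPermutationInvariant (P ℓ) (R ℓ)
  densable : IsDensable P R d

end RandomSubsets

/-- The symmetrized set of relators: all cyclic permutations of the relators and of their
inverses. -/
def symmetrized {m : ℕ} (R : Set (GWord m)) : Set (GWord m) :=
  {w | ∃ r ∈ R, w.IsRotated r ∨ w.IsRotated (FreeGroup.invRev r)}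

/-- A piece: a common initial segment of two distinct elements of the symmetrized set of
relators. -/
def IsPiece {m : ℕ} (R : Set (GWord m)) (u : GWord m) : Prop :=
  ∃ w₁ ∈ symmetrized R, ∃ w₂ ∈ symmetrized R, w₁ ≠ w₂ ∧ u <+: w₁ ∧ u <+: w₂

/-- `s` is a product of at most `p` pieces. -/
def IsProductOfPieces {m : ℕ} (R : Set (GWord m)) (p : ℕ) (s : GWord m) : Prop :=
  ∃ L : List (GWord m), L.length ≤ p ∧ (∀ u ∈ L, IsPiece R u) ∧ L.flatten = s

/-- The condition `B(2p)` for the presentation `⟨x₁, …, x_m | R⟩`: a cyclic subword of a relator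
that is a product of at most `p` pieces is shorter than half of the relator. -/
def SatisfiesB {m : ℕ} (p : ℕ) (R : Set (GWord m)) : Prop :=
  ∀ r ∈ symmetrized R, ∀ s : GWord m, s <+: r → IsProductOfPieces R p s →
    2 * s.length < r.length

/-- The variant of `B(2p)` with a non-strict inequality: a cyclic subword of a relator that is a
product of at most `p` pieces is not longer than half of the relator. -/
def SatisfiesWeakB {m : ℕ} (p : ℕ) (R : Set (GWord m)) : Prop :=
  ∀ r ∈ symmetrized R, ∀ s : GWord m, s <+: r → IsProductOfPieces R p s →
    2 * s.length ≤ r.length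

/-!
Put `b = 2m - 1`, so that there are about `b ^ k` reduced words of length `k`.

Below the critical density the first moment method applies. A violation of `B(2p)` produces a set
`T` of `k ≤ p` relators and a further relator, a cyclic conjugate of which overlaps itself or has
the proportion `(k + 1) / (2p + 2)` of its letters covered by at most `p` subwords of elements of
`T` and their inverses. Given `T`, at most about `b ^ (ℓ (1 - (k + 1) / (2p + 2)))` relators are of
this kind, so that the expected number of violations is about
`b ^ (-ℓ (k + 1) (1 / (2p + 2) - d))`.

Above it, choose `1 / (2p + 2) < β < α < d`. The relators of length `ℓ - 1` in a random set of
`b ^ (α ℓ)` words have at least `b ^ (β ℓ)` different initial segments of length just over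
`ℓ / (2p)`. About `b ^ (p β ℓ + ℓ / 2)` relators of length `ℓ` begin with `p` of these segments, and
a further random set of `b ^ (α ℓ)` words contains one of them because `α + p β > 1 / 2`.
-/

section PermutationInvariance

open Finset

variable {Ω' E : Type*} [MeasurableSpace Ω'] {P : Measure Ω'} {R : Ω' → Set E}

theorem IsRandomSubset.measurableSet_setOf [Finite E] (hR : IsRandomSubset R)
    (Q : Set E → Prop) : MeasurableSet {ω | Q (R ω)} := by
  have hunion : {ω | Q (R ω)} = ⋃ A ∈ {A | Q A}, {ω | R ω = A} := by ext ω; simp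
  rw [hunion]
  exact .biUnion (Set.toFinite _).countable fun A _ => hR A

theorem IsRandomSubset.measure_setOf [Finite E] (hR : IsRandomSubset R) (Q : Set E → Prop) :
    P {ω | Q (R ω)} = ∑' A : {A // Q A}, P {ω | R ω = A} := by
  have hunion : {ω | Q (R ω)} = ⋃ A : {A // Q A}, {ω | R ω = A} := by ext ω; simp
  refine hunion ▸ measure_iUnion ?_ fun A => hR A
  refine fun A B hAB => Set.disjoint_left.2 fun ω hA hB => hAB (Subtype.ext ?_)
  exact hA.symm.trans hB

theorem IsRandomSubset.sum_measureReal_le [Finite E] [IsProbabilityMeasure P]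
    (hR : IsRandomSubset R) {ι : Type*} [Fintype ι] (Q : ι → Set E → Prop) {c : ℝ}
    (hc : ∀ A, ({i | Q i A}.ncard : ℝ) ≤ c) : ∑ i, P.real {ω | Q i (R ω)} ≤ c := by
  classical
  have hint : ∀ i ∈ univ, Integrable ({ω | Q i (R ω)}.indicator (1 : Ω' → ℝ)) P := fun i _ =>
    (integrable_const 1).indicator (hR.measurableSet_setOf (Q i))
  calc ∑ i, P.real {ω | Q i (R ω)}
      = ∫ ω, ∑ i, {ω | Q i (R ω)}.indicator (1 : Ω' → ℝ) ω ∂P := by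
        rw [integral_finsetSum univ hint]
        exact sum_congr rfl fun i _ => (integral_indicator_one (hR.measurableSet_setOf (Q i))).symm
    _ ≤ ∫ _, c ∂P := by
        refine integral_mono (integrable_finsetSum univ hint) (integrable_const c) fun ω => ?_
        simpa [Set.indicator_apply, Set.ncard_eq_toFinset_card'] using hc (R ω)
    _ = c := by simp

theorem IsPermutationInvariant.measureReal_image [Finite E] (hP : IsPermutationInvariant P R)
    (hR : IsRandomSubset R) (σ : Equiv.Perm E) (Q : Set E → Prop) :
    P.real {ω | Q (σ '' R ω)} = P.real {ω | Q (R ω)} := by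
  let e : {A // Q (σ '' A)} ≃ {A // Q A} := (Equiv.Set.congr σ).subtypeEquiv fun _ => Iff.rfl
  rw [measureReal_def, measureReal_def, hR.measure_setOf Q, ← e.tsum_eq,
    hR.measure_setOf fun A => Q (σ '' A)]
  exact congrArg _ (tsum_congr fun A => (hP σ A).symm)

theorem exists_perm_image_subset [Finite E] {S T : Set E} (h : S.ncard ≤ T.ncard) :
    ∃ σ : Equiv.Perm E, σ '' S ⊆ T := by
  classical
  have := Fintype.ofFinite E
  obtain ⟨T', hT', hcard⟩ := Set.exists_subset_card_eq h
  have e : {x // x ∈ S} ≃ {x // x ∈ T'} := Fintype.equivOfCardEq (by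
    rw [← Nat.card_eq_fintype_card, ← Nat.card_eq_fintype_card]; exact hcard.symm)
  exact ⟨e.extendSubtype, Set.image_subset_iff.2 fun x hx => hT' (e.extendSubtype_mem x hx)⟩

theorem IsPermutationInvariant.measureReal_subset_le_of_ncard_le [Finite E]
    [IsProbabilityMeasure P] (hP : IsPermutationInvariant P R) (hR : IsRandomSubset R)
    {S T : Set E} (h : T.ncard ≤ S.ncard) (N : ℕ → Prop) :
    P.real {ω | S ⊆ R ω ∧ N (R ω).ncard} ≤ P.real {ω | T ⊆ R ω ∧ N (R ω).ncard} := by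
  obtain ⟨σ, hσ⟩ := exists_perm_image_subset h
  rw [← hP.measureReal_image hR σ.symm fun A => T ⊆ A ∧ N A.ncard]
  refine measureReal_mono fun ω hω => ⟨?_, ?_⟩
  · rw [← σ.symm_image_image T]
    exact Set.image_mono (hσ.trans hω.1)
  · rw [Set.ncard_image_of_injective _ σ.symm.injective]
    exact hω.2

theorem ncard_setOf_range_subset {ι : Type*} [Fintype ι] (A : Set E) :
    {g : ι → E | Set.range g ⊆ A}.ncard = A.ncard ^ Fintype.card ι := by
  have hpi : {g : ι → E | Set.range g ⊆ A} = Set.univ.pi fun _ => A := by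
    ext g; simp [Set.range_subset_iff]
  rw [hpi, ← Nat.card_coe_set_eq, Nat.card_congr (Equiv.Set.univPi _), Nat.card_pi]
  simp

variable [Fintype E] [IsProbabilityMeasure P]

theorem IsPermutationInvariant.measureReal_subset_mul_le (hP : IsPermutationInvariant P R)
    (hR : IsRandomSubset R) (S : Finset E) {a : ℝ} (ha : 0 ≤ a) :
    P.real {ω | ↑S ⊆ R ω ∧ (R ω).ncard ≤ a} * Fintype.card E ^ #S ≤ a ^ #S := by
  classical
  calc P.real {ω | ↑S ⊆ R ω ∧ (R ω).ncard ≤ a} * Fintype.card E ^ #S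
      = ∑ _g : Fin #S → E, P.real {ω | ↑S ⊆ R ω ∧ (R ω).ncard ≤ a} := by simp [mul_comm]
    _ ≤ ∑ g : Fin #S → E, P.real {ω | Set.range g ⊆ R ω ∧ (R ω).ncard ≤ a} := by
        refine sum_le_sum fun g _ => hP.measureReal_subset_le_of_ncard_le hR ?_ (fun n => n ≤ a)
        rw [Set.ncard_coe_finset, ← Set.image_univ, ← coe_univ]
        exact (Set.ncard_image_le (finite_toSet _)).trans (by simp)
    _ ≤ a ^ #S := hR.sum_measureReal_le (fun g A => Set.range g ⊆ A ∧ A.ncard ≤ a) fun A => ?_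
  by_cases hA : (A.ncard : ℝ) ≤ a
  · simp only [hA, and_true, ncard_setOf_range_subset, Fintype.card_fin]
    push_cast
    gcongr
  · simp only [hA, and_false, Set.ofPred_false, Set.ncard_empty, Nat.cast_zero]
    positivity

theorem IsPermutationInvariant.measureReal_exists_mul_le (hP : IsPermutationInvariant P R)
    (hR : IsRandomSubset R) (k : ℕ) (Bad : Finset E → Finset E) {q a : ℝ} (hq : 0 ≤ q)
    (ha : 0 ≤ a) (hBad : ∀ T, #T = k → #(Bad T) ≤ q) :
    P.real {ω | (∃ T : Finset E, #T = k ∧ ↑T ⊆ R ω ∧ ∃ r ∈ Bad T, r ∈ R ω ∧ r ∉ T) ∧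
      (R ω).ncard ≤ a} * Fintype.card E ≤ q * a ^ (k + 1) := by
  classical
  set n : ℝ := (Fintype.card E : ℝ)
  have hinsert : ∀ T ∈ powersetCard k (univ : Finset E), ∀ r ∈ Bad T \ T,
      P.real {ω | ↑(insert r T) ⊆ R ω ∧ (R ω).ncard ≤ a} * n ^ (k + 1) ≤ a ^ (k + 1) := by
    intro T hT r hr
    have hcard : #(insert r T) = k + 1 := by
      rw [card_insert_of_notMem (mem_sdiff.1 hr).2, (mem_powersetCard.1 hT).2]
    simpa only [hcard] using hP.measureReal_subset_mul_le hR (insert r T) ha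
  have hunion : P.real {ω | (∃ T : Finset E, #T = k ∧ ↑T ⊆ R ω ∧ ∃ r ∈ Bad T, r ∈ R ω ∧ r ∉ T) ∧
      (R ω).ncard ≤ a} ≤ ∑ T ∈ powersetCard k univ, ∑ r ∈ Bad T \ T,
        P.real {ω | ↑(insert r T) ⊆ R ω ∧ (R ω).ncard ≤ a} := by
    refine le_trans ?_ ((measureReal_biUnion_finset_le _ _).trans
      (sum_le_sum fun T _ => measureReal_biUnion_finset_le _ _))
    refine measureReal_mono ?_ (measure_ne_top _ _)
    rintro ω ⟨⟨T, hT, hTR, r, hr, hrR, hrT⟩, hω⟩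
    simp only [Set.mem_iUnion, coe_insert, Set.insert_subset_iff]
    exact ⟨T, mem_powersetCard.2 ⟨subset_univ _, hT⟩, r, mem_sdiff.2 ⟨hr, hrT⟩, ⟨hrR, hTR⟩, hω⟩
  rcases (show 0 ≤ n by positivity).eq_or_lt with hn | hn
  · rw [← hn, mul_zero]; positivity
  refine le_of_mul_le_mul_right ?_ (pow_pos hn k)
  calc _ ≤ (∑ T ∈ powersetCard k univ, ∑ r ∈ Bad T \ T,
        P.real {ω | ↑(insert r T) ⊆ R ω ∧ (R ω).ncard ≤ a}) * n ^ (k + 1) := by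
        rw [mul_assoc, ← pow_succ']; gcongr
    _ ≤ ∑ _T ∈ powersetCard k (univ : Finset E), q * a ^ (k + 1) := by
        rw [sum_mul]
        refine sum_le_sum fun T hT => ?_
        rw [sum_mul]
        refine (sum_le_sum (hinsert T hT)).trans ?_
        rw [sum_const, nsmul_eq_mul]
        have hcard : (#(Bad T \ T) : ℝ) ≤ #(Bad T) := mod_cast card_le_card sdiff_subset
        gcongr
        exact hcard.trans (hBad T (mem_powersetCard.1 hT).2)
    _ ≤ q * a ^ (k + 1) * n ^ k := by
        rw [sum_const, card_powersetCard, nsmul_eq_mul, mul_comm]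
        gcongr
        rw [card_univ]
        simp only [n]
        exact_mod_cast Nat.choose_le_pow (Fintype.card E) k

theorem ncard_perm_not_image_mul_le {X : Set E → Prop} (hX : Monotone X) {ι : Type*} [Fintype ι]
    {A : Set E} (hA : Fintype.card ι ≤ A.ncard) :
    {σ : Equiv.Perm E | ¬ X (σ '' A)}.ncard * Fintype.card E ^ Fintype.card ι ≤
      Nat.card (Equiv.Perm E) * {g : ι → E | ¬ X (Set.range g)}.ncard := by
  classical
  have hle : ∀ g : ι → E, {σ : Equiv.Perm E | ¬ X (σ '' A)}.ncard ≤
      {σ : Equiv.Perm E | ¬ X (σ '' Set.range g)}.ncard := by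
    intro g
    have hrange : (Set.range g).ncard ≤ A.ncard := by
      rw [← Set.image_univ]
      refine (Set.ncard_image_le Set.finite_univ).trans ?_
      rwa [Set.ncard_univ, Nat.card_eq_fintype_card]
    obtain ⟨τ, hτ⟩ := exists_perm_image_subset hrange
    refine Set.ncard_le_ncard_of_injOn (· * τ) (fun σ hσ => mt (hX ?_) hσ)
      (mul_left_injective τ).injOn
    rw [Equiv.Perm.coe_mul, Set.image_comp]
    exact Set.image_mono hτ
  have heq : ∀ σ : Equiv.Perm E, {g : ι → E | ¬ X (σ '' Set.range g)}.ncard =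
      {g : ι → E | ¬ X (Set.range g)}.ncard := fun σ =>
    Nat.card_congr (((Equiv.refl ι).arrowCongr σ).subtypeEquiv fun g => by
      simp [Equiv.arrowCongr, Set.range_comp])
  have hswap : ∑ g : ι → E, {σ : Equiv.Perm E | ¬ X (σ '' Set.range g)}.ncard =
      ∑ σ : Equiv.Perm E, {g : ι → E | ¬ X (σ '' Set.range g)}.ncard := by
    simpa only [Set.ncard_eq_toFinset_card', Set.toFinset_ofPred, bipartiteAbove,
      bipartiteBelow] using sum_card_bipartiteAbove_eq_sum_card_bipartiteBelow
        fun (g : ι → E) (σ : Equiv.Perm E) => ¬ X (σ '' Set.range g)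
  calc _ = ∑ _g : ι → E, {σ : Equiv.Perm E | ¬ X (σ '' A)}.ncard := by simp [mul_comm]
    _ ≤ ∑ g : ι → E, {σ : Equiv.Perm E | ¬ X (σ '' Set.range g)}.ncard :=
        sum_le_sum fun g _ => hle g
    _ = _ := by simp [hswap, heq]

theorem IsPermutationInvariant.measureReal_not_mul_le (hP : IsPermutationInvariant P R)
    (hR : IsRandomSubset R) {X : Set E → Prop} (hX : Monotone X) (ι : Type*) [Fintype ι] :
    P.real {ω | ¬ X (R ω) ∧ Fintype.card ι ≤ (R ω).ncard} * Fintype.card E ^ Fintype.card ι ≤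
      {g : ι → E | ¬ X (Set.range g)}.ncard := by
  -- By invariance `R` may be replaced by `σ(R)` for a uniform permutation `σ`, and a sample with
  -- repetitions of size at most `|R|` can be moved into `σ(R)`.
  classical
  set n : ℝ := (Fintype.card E : ℝ) ^ Fintype.card ι with hn_def
  rcases (show 0 ≤ n by positivity).eq_or_lt with hn | hn
  · rw [← hn, mul_zero]; positivity
  have hcount : ∀ A : Set E,
      ({σ : Equiv.Perm E | ¬ X (σ '' A) ∧ Fintype.card ι ≤ (σ '' A).ncard}.ncard : ℝ) * n ≤
        Nat.card (Equiv.Perm E) * {g : ι → E | ¬ X (Set.range g)}.ncard := by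
    intro A
    simp only [Set.ncard_image_of_injective A (Equiv.injective _)]
    by_cases hA : Fintype.card ι ≤ A.ncard
    · simp only [hA, and_true, hn_def]
      exact_mod_cast ncard_perm_not_image_mul_le hX hA
    · simp only [hA, and_false, Set.ofPred_false, Set.ncard_empty, Nat.cast_zero, zero_mul]
      positivity
  have hsum := hR.sum_measureReal_le (P := P)
    (fun (σ : Equiv.Perm E) A => ¬ X (σ '' A) ∧ Fintype.card ι ≤ (σ '' A).ncard)
    fun A => (le_div_iff₀ hn).2 (hcount A)
  simp only [fun σ => hP.measureReal_image hR σ fun A => ¬ X A ∧ Fintype.card ι ≤ A.ncard,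
    sum_const, card_univ, nsmul_eq_mul, mul_div_assoc,
    ← Nat.card_eq_fintype_card (α := Equiv.Perm E)] at hsum
  exact (le_div_iff₀ hn).1 (le_of_mul_le_mul_left hsum (mod_cast Nat.card_pos))

theorem ncard_setOf_forall_notMem_le (B : Finset E) {x : ℝ} (hB : x * Fintype.card E ≤ #B)
    (ι : Type*) [Fintype ι] :
    ({g : ι → E | ∀ i, g i ∉ B}.ncard : ℝ) ≤
      Real.exp (-x * Fintype.card ι) * Fintype.card E ^ Fintype.card ι := by
  classical
  have hcompl : (#Bᶜ : ℝ) ≤ Real.exp (-x) * Fintype.card E := by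
    have hsum : (#Bᶜ : ℝ) + #B = Fintype.card E := mod_cast card_compl_add_card B
    nlinarith [Real.add_one_le_exp (-x), (Nat.cast_nonneg (Fintype.card E) : (0 : ℝ) ≤ _)]
  have hncard := ncard_setOf_range_subset (ι := ι) ((Bᶜ : Finset E) : Set E)
  simp only [Set.range_subset_iff, mem_coe, mem_compl, Set.ncard_coe_finset] at hncard
  rw [hncard, Nat.cast_pow, mul_comm (-x), Real.exp_nat_mul, ← mul_pow]
  gcongr

theorem ncard_setOf_card_hit_lt_le {W ι : Type*} [Fintype ι] (B : W → Finset E) (U : Finset W)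
    {K : ℕ} (hKU : K ≤ #U) {x : ℝ} [DecidableEq W] [DecidableEq E]
    (hB : ∀ D ⊆ U, #D = K → x * Fintype.card E ≤ #((U \ D).biUnion B)) :
    ({g : ι → E | ∀ D ⊆ U, #D = K → ∃ u ∈ D, ∀ i, g i ∉ B u}.ncard : ℝ) ≤
      #U ^ K * (Real.exp (-x * Fintype.card ι) * Fintype.card E ^ Fintype.card ι) := by
  classical
  have hsub : {g : ι → E | ∀ D ⊆ U, #D = K → ∃ u ∈ D, ∀ i, g i ∉ B u} ⊆
      ⋃ D ∈ powersetCard K U, {g | ∀ i, g i ∉ (U \ D).biUnion B} := by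
    intro g hg
    have hhit : #{u ∈ U | ∃ i, g i ∈ B u} ≤ K := by
      by_contra! hlt
      obtain ⟨D, hDsub, hDK⟩ := exists_subset_card_eq hlt.le
      obtain ⟨u, hu, hgu⟩ := hg D (hDsub.trans (filter_subset _ _)) hDK
      obtain ⟨i, hi⟩ := (mem_filter.1 (hDsub hu)).2
      exact hgu i hi
    obtain ⟨D, hhitD, hDU, hDK⟩ :=
      exists_subsuperset_card_eq (filter_subset (fun u => ∃ i, g i ∈ B u) U) hhit hKU
    refine Set.mem_biUnion (mem_powersetCard.2 ⟨hDU, hDK⟩) fun i hi => ?_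
    obtain ⟨u, hu, hi⟩ := mem_biUnion.1 hi
    exact (mem_sdiff.1 hu).2 (hhitD (mem_filter.2 ⟨(mem_sdiff.1 hu).1, i, hi⟩))
  calc _ ≤ ∑ D ∈ powersetCard K U, ({g : ι → E | ∀ i, g i ∉ (U \ D).biUnion B}.ncard : ℝ) :=
        mod_cast (Set.ncard_le_ncard hsub).trans (Finset.set_ncard_biUnion_le _ _)
    _ ≤ ∑ _D ∈ powersetCard K U,
          Real.exp (-x * Fintype.card ι) * Fintype.card E ^ Fintype.card ι :=
        sum_le_sum fun D hD => ncard_setOf_forall_notMem_le _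
          (hB D (mem_powersetCard.1 hD).1 (mem_powersetCard.1 hD).2) ι
    _ ≤ _ := by
        rw [sum_const, card_powersetCard, nsmul_eq_mul]
        gcongr
        exact mod_cast Nat.choose_le_pow _ K

/-- The conclusion of the two-sample argument: `K` of the cells `B u` with `u ∈ U` meet `A`, and
`A` also meets the target set `G D` of a set `D` of `K` such cells. -/
def HitsTarget {W E : Type*} (U : Finset W) (K : ℕ) (B : W → Finset E)
    (G : Finset W → Finset E) (A : Set E) : Prop :=
  ∃ D ⊆ U, #D = K ∧ (∀ u ∈ D, (A ∩ B u).Nonempty) ∧ (A ∩ G D).Nonempty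

theorem monotone_hitsTarget {W E : Type*} (U : Finset W) (K : ℕ) (B : W → Finset E)
    (G : Finset W → Finset E) : Monotone (HitsTarget U K B G) := by
  rintro A A' h ⟨D, hDU, hDK, hB, hG⟩
  exact ⟨D, hDU, hDK, fun u hu => (hB u hu).mono (Set.inter_subset_inter_left _ h),
    hG.mono (Set.inter_subset_inter_left _ h)⟩

theorem ncard_setOf_sum_eq_sum_ncard {ι κ : Type*} [Fintype ι] [Finite κ] [DecidableEq ι]
    (Q : (ι ⊕ κ → E) → Prop) : {g | Q g}.ncard = ∑ g₁, {g₂ | Q (Sum.elim g₁ g₂)}.ncard := by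
  let e : {g // Q g} ≃ {g : (ι → E) × (κ → E) // Q (Sum.elim g.1 g.2)} :=
    (Equiv.sumArrowEquivProdArrow ι κ E).subtypeEquiv fun g => by
      simp [Equiv.sumArrowEquivProdArrow]
  rw [← Nat.card_coe_set_eq, Set.coe_ofPred, Nat.card_congr (e.trans
    (Equiv.subtypeProdEquivSigmaSubtype fun g₁ g₂ => Q (Sum.elim g₁ g₂))), Nat.card_sigma]
  rfl

theorem ncard_setOf_not_hitsTarget_le {W : Type*} [DecidableEq W] [DecidableEq E] {U : Finset W}
    {K : ℕ} (hKU : K ≤ #U) {B : W → Finset E} {G : Finset W → Finset E} {x y : ℝ}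
    (hB : ∀ D ⊆ U, #D = K → x * Fintype.card E ≤ #((U \ D).biUnion B))
    (hG : ∀ D ⊆ U, #D = K → y * Fintype.card E ≤ #(G D)) (ι : Type*) [Fintype ι] :
    ({g : ι ⊕ ι → E | ¬ HitsTarget U K B G (Set.range g)}.ncard : ℝ) ≤
      (#U ^ K * Real.exp (-x * Fintype.card ι) + Real.exp (-y * Fintype.card ι)) *
        Fintype.card E ^ Fintype.card (ι ⊕ ι) := by
  classical
  set N : ℝ := (Fintype.card E : ℝ) ^ Fintype.card ι with hN
  set miss : Set (ι → E) := {g | ∀ D ⊆ U, #D = K → ∃ u ∈ D, ∀ i, g i ∉ B u}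
  have hsecond : ∀ g₁ : ι → E,
      ({g₂ : ι → E | ¬ HitsTarget U K B G (Set.range (Sum.elim g₁ g₂))}.ncard : ℝ) ≤
        (if g₁ ∈ miss then N else 0) + Real.exp (-y * Fintype.card ι) * N := by
    intro g₁
    split_ifs with hg₁
    · refine le_add_of_le_of_nonneg ?_ (by positivity)
      rw [hN, ← Nat.cast_pow, ← Fintype.card_fun, ← Nat.card_eq_fintype_card]
      exact mod_cast Set.ncard_le_card _
    · simp only [miss, Set.mem_ofPred_eq, not_forall, not_exists, not_and, not_not] at hg₁
      obtain ⟨D, hDU, hDK, hD⟩ := hg₁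
      rw [zero_add]
      refine le_trans ?_ (ncard_setOf_forall_notMem_le (G D) (hG D hDU hDK) ι)
      refine Nat.cast_le.2 (Set.ncard_le_ncard fun g₂ hg₂ i hi => hg₂ ⟨D, hDU, hDK, ?_, ?_⟩)
      · intro u hu
        obtain ⟨j, hj⟩ := hD u hu
        exact ⟨g₁ j, ⟨Sum.inl j, rfl⟩, hj⟩
      · exact ⟨g₂ i, ⟨Sum.inr i, rfl⟩, hi⟩
  calc _ ≤ ∑ g₁ : ι → E, ((if g₁ ∈ miss then N else 0) + Real.exp (-y * Fintype.card ι) * N) := by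
        rw [ncard_setOf_sum_eq_sum_ncard, Nat.cast_sum]
        exact sum_le_sum fun g₁ _ => hsecond g₁
    _ = miss.ncard * N + N * (Real.exp (-y * Fintype.card ι) * N) := by
        rw [sum_add_distrib, ← sum_filter, Set.ncard_eq_toFinset_card']
        simp [hN, Set.toFinset]
    _ ≤ #U ^ K * (Real.exp (-x * Fintype.card ι) * N) * N +
          N * (Real.exp (-y * Fintype.card ι) * N) := by
        gcongr
        exact ncard_setOf_card_hit_lt_le B U hKU hB
    _ = _ := by rw [Fintype.card_sum, pow_add]; ring

theorem IsPermutationInvariant.measureReal_not_hitsTarget_le (hP : IsPermutationInvariant P R)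
    (hR : IsRandomSubset R) {W : Type*} [DecidableEq W] [DecidableEq E] [Nonempty E]
    {U : Finset W} {K : ℕ} (hKU : K ≤ #U) {B : W → Finset E} {G : Finset W → Finset E} {x y : ℝ}
    (hB : ∀ D ⊆ U, #D = K → x * Fintype.card E ≤ #((U \ D).biUnion B))
    (hG : ∀ D ⊆ U, #D = K → y * Fintype.card E ≤ #(G D)) (M : ℕ) :
    P.real {ω | ¬ HitsTarget U K B G (R ω) ∧ 2 * M ≤ (R ω).ncard} ≤
      #U ^ K * Real.exp (-x * M) + Real.exp (-y * M) := by
  have hn : (0 : ℝ) < Fintype.card E ^ (2 * M) :=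
    pow_pos (mod_cast Fintype.card_pos) _
  have hsample := (hP.measureReal_not_mul_le hR (monotone_hitsTarget U K B G) (Fin M ⊕ Fin M)).trans
    (ncard_setOf_not_hitsTarget_le hKU hB hG (Fin M))
  simp only [Fintype.card_sum, Fintype.card_fin, ← two_mul] at hsample
  exact le_of_mul_le_mul_right hsample hn

end PermutationInvariance

section Words

open Finset

variable {α : Type*}

theorem imp_snd_eq_iff_ne_inv {x y : α × Bool} : (x.1 = y.1 → x.2 = y.2) ↔ y ≠ (x.1, !x.2) := by
  obtain ⟨a, b⟩ := x
  obtain ⟨c, d⟩ := y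
  cases b <;> cases d <;> simp [Prod.ext_iff, eq_comm]

theorem isReduced_cons_cons_iff_ne_inv {x y : α × Bool} {w : List (α × Bool)} :
    FreeGroup.IsReduced (x :: y :: w) ↔ y ≠ (x.1, !x.2) ∧ FreeGroup.IsReduced (y :: w) := by
  rw [FreeGroup.isReduced_cons_cons, imp_snd_eq_iff_ne_inv]

theorem isReduced_append_iff_ne_inv {w v : List (α × Bool)} :
    FreeGroup.IsReduced (w ++ v) ↔ FreeGroup.IsReduced w ∧ FreeGroup.IsReduced v ∧
      ∀ x ∈ w.getLast?, ∀ y ∈ v.head?, y ≠ (x.1, !x.2) := by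
  simp only [FreeGroup.IsReduced, List.isChain_append, imp_snd_eq_iff_ne_inv]

theorem isReduced_invRev {w : List (α × Bool)} (h : FreeGroup.IsReduced w) :
    FreeGroup.IsReduced (FreeGroup.invRev w) := by
  classical
  rw [FreeGroup.isReduced_iff_reduce_eq] at h ⊢
  rw [FreeGroup.reduce_invRev, h]

theorem eq_nil_of_eq_invRev {w : List (α × Bool)} (h : FreeGroup.IsReduced w)
    (hw : w = FreeGroup.invRev w) : w = [] := by
  classical
  have hsq : FreeGroup.mk w ^ 2 = 1 := by
    rw [pow_two]
    nth_rewrite 2 [hw]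
    rw [← FreeGroup.inv_mk, mul_inv_cancel]
  have hone := congrArg FreeGroup.toWord ((pow_eq_one_iff_left two_ne_zero).1 hsq)
  rwa [FreeGroup.toWord_mk, h.reduce_eq, FreeGroup.toWord_one] at hone

theorem isCyclicallyReduced_iff_isReduced_append {w : List (α × Bool)} :
    FreeGroup.IsCyclicallyReduced w ↔ FreeGroup.IsReduced (w ++ w) := by
  rw [FreeGroup.isCyclicallyReduced_iff, FreeGroup.IsReduced, FreeGroup.IsReduced,
    List.isChain_append]
  exact ⟨fun h => ⟨h.1, h.1, h.2⟩, fun h => ⟨h.1, h.2.2⟩⟩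

theorem isCyclicallyReduced_of_isRotated {w v : List (α × Bool)}
    (h : FreeGroup.IsCyclicallyReduced w) (hv : w.IsRotated v) :
    FreeGroup.IsCyclicallyReduced v := by
  rcases eq_or_ne w [] with rfl | hne
  · exact List.isRotated_nil_iff'.1 hv ▸ h
  obtain ⟨n, hn, rfl⟩ := List.isRotated_iff_mod.1 hv
  rw [isCyclicallyReduced_iff_isReduced_append] at h ⊢
  refine (h.append_overlap h hne).infix ⟨w.take n, w.drop n, ?_⟩
  rw [List.rotate_eq_drop_append_take hn]
  calc _ = (w.take n ++ w.drop n) ++ (w.take n ++ w.drop n) ++ (w.take n ++ w.drop n) := by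
        simp only [List.append_assoc]
    _ = _ := by rw [List.take_append_drop]

theorem isCyclicallyReduced_invRev {w : List (α × Bool)} (h : FreeGroup.IsCyclicallyReduced w) :
    FreeGroup.IsCyclicallyReduced (FreeGroup.invRev w) := by
  rw [isCyclicallyReduced_iff_isReduced_append] at h ⊢
  rw [← FreeGroup.invRev_append]
  exact isReduced_invRev h

theorem isRotated_invRev {w v : List (α × Bool)} (h : w.IsRotated v) :
    (FreeGroup.invRev w).IsRotated (FreeGroup.invRev v) :=
  (h.map _).reverse

theorem isRotated_invRev_comm {w v : List (α × Bool)} :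
    w.IsRotated (FreeGroup.invRev v) ↔ (FreeGroup.invRev w).IsRotated v :=
  ⟨fun h => by simpa using isRotated_invRev h, fun h => by simpa using isRotated_invRev h⟩

theorem exists_isRotated_isPrefix_of_isInfix {β : Type*} {u w : List β} (h : u <:+: w) :
    ∃ v, v.IsRotated w ∧ u <+: v := by
  obtain ⟨s, t, rfl⟩ := h
  exact ⟨u ++ t ++ s, by rw [List.append_assoc s]; exact List.isRotated_append, t ++ s, by simp⟩

/-- A word is anchored at the letter `x` if it is reduced, begins with `x` and does not end with
the inverse of `x`: concatenations of such words are cyclically reduced. -/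
def IsAnchored (x : α × Bool) (w : List (α × Bool)) : Prop :=
  FreeGroup.IsReduced w ∧ w.head? = some x ∧ w.getLast? ≠ some (x.1, !x.2)

theorem IsAnchored.ne_nil {x : α × Bool} {w : List (α × Bool)} (h : IsAnchored x w) : w ≠ [] := by
  rintro rfl
  simpa using h.2.1

theorem IsAnchored.append {x : α × Bool} {w v : List (α × Bool)} (hw : IsAnchored x w)
    (hv : IsAnchored x v) : IsAnchored x (w ++ v) := by
  refine ⟨isReduced_append_iff_ne_inv.2 ⟨hw.1, hv.1, ?_⟩, ?_, ?_⟩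
  · rintro y hy z hz rfl
    rw [hv.2.1, Option.mem_some_iff] at hz
    exact hw.2.2 (by rw [Option.mem_def.1 hy, hz, Bool.not_not])
  · rw [List.head?_append_of_ne_nil _ hw.ne_nil, hw.2.1]
  · rw [List.getLast?_append_of_ne_nil _ hv.ne_nil]
    exact hv.2.2

theorem IsAnchored.isCyclicallyReduced {x : α × Bool} {w : List (α × Bool)}
    (h : IsAnchored x w) : FreeGroup.IsCyclicallyReduced w :=
  isCyclicallyReduced_iff_isReduced_append.2 (h.append h).1

theorem exists_ne_and_ne [Fintype α] (hα : 2 ≤ Fintype.card α) (x y : α × Bool) :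
    ∃ z, z ≠ x ∧ z ≠ y := by
  classical
  have hcard : #{x, y} < #(univ : Finset (α × Bool)) := by
    rw [card_univ, Fintype.card_prod, Fintype.card_bool]
    exact card_le_two.trans_lt (by omega)
  obtain ⟨z, -, hz⟩ := exists_mem_notMem_of_card_lt_card hcard
  exact ⟨z, by simpa using hz⟩

variable [Fintype α] [DecidableEq α]

/-- The words `w` of length `k` for which `x :: w` is reduced. -/
def continuations (x : α × Bool) : ℕ → Finset (List (α × Bool))
  | 0 => {[]}
  | k + 1 => ((univ : Finset (α × Bool)).erase (x.1, !x.2)).biUnion fun y =>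
      (continuations y k).image (List.cons y)

theorem mem_continuations {x : α × Bool} {k : ℕ} {w : List (α × Bool)} :
    w ∈ continuations x k ↔ w.length = k ∧ FreeGroup.IsReduced (x :: w) := by
  induction k generalizing x w with
  | zero =>
    rw [continuations, mem_singleton, List.length_eq_zero_iff]
    exact ⟨by rintro rfl; simp, And.left⟩
  | succ k ih =>
    simp only [continuations, mem_biUnion, mem_erase, mem_univ, and_true, mem_image]
    constructor
    · rintro ⟨y, hy, w', hw', rfl⟩
      obtain ⟨hlen, hred⟩ := ih.1 hw'
      exact ⟨by simp [hlen], isReduced_cons_cons_iff_ne_inv.2 ⟨hy, hred⟩⟩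
    · rintro ⟨hlen, hred⟩
      obtain _ | ⟨y, w'⟩ := w
      · simp at hlen
      · rw [isReduced_cons_cons_iff_ne_inv] at hred
        exact ⟨y, hred.1, w', ih.2 ⟨by simpa using hlen, hred.2⟩, rfl⟩

theorem card_continuations (x : α × Bool) (k : ℕ) :
    #(continuations x k) = (2 * Fintype.card α - 1) ^ k := by
  induction k generalizing x with
  | zero => simp [continuations]
  | succ k ih =>
    have hcons : ∀ y ∈ (univ : Finset (α × Bool)).erase (x.1, !x.2),
        #((continuations y k).image (List.cons y)) = (2 * Fintype.card α - 1) ^ k := fun y _ => by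
      rw [card_image_of_injective _ List.cons_injective, ih]
    rw [continuations, card_biUnion, sum_congr rfl hcons, sum_const, card_erase_of_mem (mem_univ _),
      card_univ, Fintype.card_prod, Fintype.card_bool, smul_eq_mul, pow_succ', mul_comm _ 2]
    intro y _ z _ hyz
    refine Finset.disjoint_left.2 fun w hw hw' => hyz ?_
    obtain ⟨_, _, rfl⟩ := mem_image.1 hw
    obtain ⟨_, _, h⟩ := mem_image.1 hw'
    exact (List.cons.inj h).1.symm

variable (α) in
/-- The reduced words of length `k`. -/
def reducedWords : ℕ → Finset (List (α × Bool))
  | 0 => {[]}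
  | k + 1 => (univ : Finset (α × Bool)).biUnion fun y => (continuations y k).image (List.cons y)

theorem mem_reducedWords {k : ℕ} {w : List (α × Bool)} :
    w ∈ reducedWords α k ↔ w.length = k ∧ FreeGroup.IsReduced w := by
  cases k with
  | zero =>
    rw [reducedWords, mem_singleton, List.length_eq_zero_iff]
    exact ⟨by rintro rfl; simp, And.left⟩
  | succ k =>
    simp only [reducedWords, mem_biUnion, mem_univ, true_and, mem_image, mem_continuations]
    constructor
    · rintro ⟨y, w', ⟨hlen, hred⟩, rfl⟩
      exact ⟨by simp [hlen], hred⟩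
    · rintro ⟨hlen, hred⟩
      obtain _ | ⟨y, w'⟩ := w
      · simp at hlen
      · exact ⟨y, w', ⟨by simpa using hlen, hred⟩, rfl⟩

theorem card_reducedWords_le (k : ℕ) :
    #(reducedWords α k) ≤ 2 * (2 * Fintype.card α - 1) ^ k := by
  cases k with
  | zero => simp [reducedWords]
  | succ k =>
    calc #(reducedWords α (k + 1))
        ≤ #(univ : Finset (α × Bool)) * (2 * Fintype.card α - 1) ^ k :=
          card_biUnion_le_card_mul _ _ _ fun y _ => card_image_le.trans (card_continuations y k).le
      _ = (Fintype.card α * 2) * (2 * Fintype.card α - 1) ^ k := by simp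
      _ ≤ (2 * (2 * Fintype.card α - 1)) * (2 * Fintype.card α - 1) ^ k :=
          Nat.mul_le_mul_right _ (by omega)
      _ = _ := by ring

open Classical in
/-- The words of length `k` that are anchored at `x`. -/
noncomputable def anchoredWords (x : α × Bool) (k : ℕ) : Finset (List (α × Bool)) :=
  {w ∈ reducedWords α k | IsAnchored x w}

theorem mem_anchoredWords {x : α × Bool} {k : ℕ} {w : List (α × Bool)} :
    w ∈ anchoredWords x k ↔ w.length = k ∧ IsAnchored x w := by
  simp only [anchoredWords, mem_filter, mem_reducedWords, and_assoc]
  exact ⟨fun h => ⟨h.1, h.2.2⟩, fun h => ⟨h.1, h.2.1, h.2⟩⟩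

theorem pow_le_card_anchoredWords (hα : 2 ≤ Fintype.card α) (x : α × Bool) (k : ℕ) :
    (2 * Fintype.card α - 1) ^ k ≤ #(anchoredWords x (k + 2)) := by
  choose f hf using fun y : α × Bool => exists_ne_and_ne hα (y.1, !y.2) (x.1, !x.2)
  rw [← card_continuations x k]
  refine card_le_card_of_injOn
    (fun w => (x :: w) ++ [f ((x :: w).getLast (List.cons_ne_nil _ _))]) ?_ ?_
  · intro w hw
    obtain ⟨hlen, hred⟩ := mem_continuations.1 (mem_coe.1 hw)
    refine mem_coe.2 (mem_anchoredWords.2 ⟨by simp [hlen], ?_, by simp, ?_⟩)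
    · refine isReduced_append_iff_ne_inv.2 ⟨hred, by simp, fun y hy z hz => ?_⟩
      rw [List.getLast?_eq_getLast_of_ne_nil (List.cons_ne_nil _ _), Option.mem_some_iff] at hy
      rw [List.head?_cons, Option.mem_some_iff] at hz
      rw [← hz, ← hy]
      exact (hf _).1
    · rw [List.getLast?_append_of_ne_nil _ (by simp), List.getLast?_singleton]
      exact fun h => (hf _).2 (Option.some.inj h)
  · intro w _ w' _ h
    exact (List.cons.inj (List.append_inj' h rfl).1).2

end Words

section CoveredWords

open Finset

theorem card_biUnion_mul_le {ι β : Type*} [DecidableEq β] {s : Finset ι} {t : ι → Finset β}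
    {x C : ℕ} (h : ∀ i ∈ s, #(t i) * x ≤ C) : #(s.biUnion t) * x ≤ #s * C := by
  calc #(s.biUnion t) * x ≤ (∑ i ∈ s, #(t i)) * x := Nat.mul_le_mul_right _ card_biUnion_le
    _ = ∑ i ∈ s, #(t i) * x := sum_mul _ _ _
    _ ≤ #s * C := by simpa using sum_le_card_nsmul _ _ _ h

variable {α : Type*} [DecidableEq α]

/-- The total length of the words of the list `L` that belong to `V`. -/
def totalLengthIn (V : Finset (List α)) (L : List (List α)) : ℕ :=
  ((L.filter (· ∈ V)).map List.length).sum

theorem totalLengthIn_nil (V : Finset (List α)) : totalLengthIn V [] = 0 := rfl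

theorem totalLengthIn_cons (V : Finset (List α)) (u : List α) (L : List (List α)) :
    totalLengthIn V (u :: L) = (if u ∈ V then u.length else 0) + totalLengthIn V L := by
  by_cases h : u ∈ V <;> simp [totalLengthIn, h]

theorem mul_length_flatten_add_le {V : Finset (List α)} {L : List (List α)} {N n : ℕ}
    (h : ∀ u ∈ L, N * u.length ≤ n ∨ u ∈ V) :
    N * L.flatten.length + L.countP (n < N * ·.length) * n
      ≤ N * totalLengthIn V L + L.length * n := by
  induction L with
  | nil => simp
  | cons u L ih =>
    obtain ⟨hu, hL⟩ := List.forall_mem_cons.1 h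
    have hle := ih hL
    rw [List.flatten_cons, List.length_append, List.length_cons, totalLengthIn_cons,
      List.countP_cons]
    by_cases hlong : n < N * u.length
    · rw [if_pos (hu.resolve_left hlong.not_ge), if_pos (by simpa using hlong)]
      linarith
    · rw [if_neg (by simpa using hlong)]
      have hnonneg := Nat.zero_le (N * if u ∈ V then u.length else 0)
      linarith

theorem card_biUnion_image_append_mul_le {F : ℕ → ℕ → Finset (List α)} {b C N : ℕ} (hb : 0 < b)
    (hF : ∀ n ≤ N, ∀ f, #(F n f) * b ^ f ≤ C * b ^ n) (V : Finset (List α)) {n : ℕ}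
    (hn : n ≤ N) (f : ℕ) :
    #({v ∈ V | v.length ≤ n}.biUnion fun v =>
      (F (n - v.length) (f - v.length)).image (v ++ ·)) * b ^ f ≤ #V * (C * b ^ n) := by
  refine (card_biUnion_mul_le fun v hv => ?_).trans
    (Nat.mul_le_mul_right _ (card_filter_le V fun v => v.length ≤ n))
  calc _ ≤ #(F (n - v.length) (f - v.length)) * (b ^ (f - v.length) * b ^ v.length) := by
        rw [← pow_add]
        exact Nat.mul_le_mul card_image_le (Nat.pow_le_pow_right hb (by omega))
    _ = #(F (n - v.length) (f - v.length)) * b ^ (f - v.length) * b ^ v.length :=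
        (mul_assoc _ _ _).symm
    _ ≤ C * b ^ (n - v.length) * b ^ v.length :=
        Nat.mul_le_mul_right _ (hF _ (by omega) _)
    _ = C * b ^ n := by rw [mul_assoc, ← pow_add, Nat.sub_add_cancel (mem_filter.1 hv).2]

variable [Fintype α]

open Classical in
/-- The reduced words of length `n` with an initial segment that is a product of at most `q` words,
of which those in `V` have total length at least `f`. -/
noncomputable def coveredWords (V : Finset (List (α × Bool))) (q n f : ℕ) :
    Finset (List (α × Bool)) :=
  {w ∈ reducedWords α n | ∃ L : List (List (α × Bool)),
    L.length ≤ q ∧ L.flatten <+: w ∧ f ≤ totalLengthIn V L}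

theorem mem_coveredWords {V : Finset (List (α × Bool))} {q n f : ℕ} {w : List (α × Bool)} :
    w ∈ coveredWords V q n f ↔ (w.length = n ∧ FreeGroup.IsReduced w) ∧
      ∃ L : List (List (α × Bool)),
        L.length ≤ q ∧ L.flatten <+: w ∧ f ≤ totalLengthIn V L := by
  classical rw [coveredWords, mem_filter, mem_reducedWords]

theorem coveredWords_zero_of_pos (V : Finset (List (α × Bool))) (n : ℕ) {f : ℕ} (hf : 0 < f) :
    coveredWords V 0 n f = ∅ := by
  refine eq_empty_iff_forall_notMem.2 fun w hw => ?_
  obtain ⟨-, L, hL, -, h⟩ := mem_coveredWords.1 hw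
  obtain rfl : L = [] := by simpa using hL
  rw [totalLengthIn_nil] at h
  omega

theorem coveredWords_succ_subset (V : Finset (List (α × Bool))) (q n f : ℕ) :
    coveredWords V (q + 1) n f ⊆
      ({v ∈ V | v.length ≤ n}.biUnion fun v =>
        (coveredWords V q (n - v.length) (f - v.length)).image (v ++ ·)) ∪
      (range (n + 1)).biUnion fun l =>
        image₂ (· ++ ·) (reducedWords α l) (coveredWords V q (n - l) f) := by
  intro w hw
  obtain ⟨⟨hlen, hred⟩, L, hL, hpre, hf⟩ := mem_coveredWords.1 hw
  rw [mem_union]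
  obtain _ | ⟨u, L⟩ := L
  · refine Or.inr (mem_biUnion.2 ⟨0, by simp, mem_image₂.2 ⟨[], ?_, w, ?_, rfl⟩⟩)
    · simp [mem_reducedWords]
    · exact mem_coveredWords.2 ⟨⟨hlen, hred⟩, [], by simp, by simp, hf⟩
  rw [List.flatten_cons] at hpre
  obtain ⟨t, rfl⟩ := (List.prefix_append u L.flatten).trans hpre
  rw [List.prefix_append_right_inj] at hpre
  rw [totalLengthIn_cons] at hf
  rw [List.length_append] at hlen
  have ht : FreeGroup.IsReduced t := hred.infix (List.suffix_append u t).isInfix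
  have hu : FreeGroup.IsReduced u := hred.infix (List.prefix_append u t).isInfix
  have hL' : L.length ≤ q := by simpa using hL
  by_cases huV : u ∈ V
  · rw [if_pos huV] at hf
    refine Or.inl (mem_biUnion.2
      ⟨u, mem_filter.2 ⟨huV, by omega⟩, mem_image.2 ⟨t, mem_coveredWords.2 ?_, rfl⟩⟩)
    exact ⟨⟨by omega, ht⟩, L, hL', hpre, by omega⟩
  · rw [if_neg huV, zero_add] at hf
    refine Or.inr (mem_biUnion.2 ⟨u.length, Finset.mem_range.2 (by omega),
      mem_image₂.2 ⟨u, mem_reducedWords.2 ⟨rfl, hu⟩, t, mem_coveredWords.2 ?_, rfl⟩⟩)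
    exact ⟨⟨by omega, ht⟩, L, hL', hpre, hf⟩

theorem card_biUnion_image₂_append_mul_le {F : ℕ → ℕ → Finset (List (α × Bool))} {C N : ℕ}
    (hF : ∀ n ≤ N, ∀ f, #(F n f) * (2 * Fintype.card α - 1) ^ f
      ≤ C * (2 * Fintype.card α - 1) ^ n) {n : ℕ} (hn : n ≤ N) (f : ℕ) :
    #((range (n + 1)).biUnion fun l => image₂ (· ++ ·) (reducedWords α l) (F (n - l) f))
      * (2 * Fintype.card α - 1) ^ f
      ≤ (n + 1) * (2 * (C * (2 * Fintype.card α - 1) ^ n)) := by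
  set b := 2 * Fintype.card α - 1
  refine (card_biUnion_mul_le (C := 2 * (C * b ^ n)) fun l hl => ?_).trans
    (by rw [card_range])
  calc _ ≤ (2 * b ^ l * #(F (n - l) f)) * b ^ f := by
        refine Nat.mul_le_mul_right _ ((card_image₂_le _ _ _).trans ?_)
        exact Nat.mul_le_mul_right _ (card_reducedWords_le l)
    _ = 2 * b ^ l * (#(F (n - l) f) * b ^ f) := mul_assoc _ _ _
    _ ≤ 2 * b ^ l * (C * b ^ (n - l)) := Nat.mul_le_mul_left _ (hF _ (by omega) _)
    _ = 2 * (C * (b ^ (n - l) * b ^ l)) := by ring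
    _ = 2 * (C * b ^ n) := by
        rw [← pow_add, Nat.sub_add_cancel (Nat.lt_succ_iff.1 (Finset.mem_range.1 hl))]

theorem card_coveredWords_mul_le [Nonempty α] (V : Finset (List (α × Bool))) (q : ℕ) {n N : ℕ}
    (hn : n ≤ N) (f : ℕ) :
    #(coveredWords V q n f) * (2 * Fintype.card α - 1) ^ f
      ≤ 2 * (#V + 2 * (N + 1)) ^ q * (2 * Fintype.card α - 1) ^ n := by
  have hb : 0 < 2 * Fintype.card α - 1 := by
    have := Fintype.card_pos (α := α)
    omega
  induction q generalizing n f with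
  | zero =>
    rcases Nat.eq_zero_or_pos f with rfl | hf
    · simp only [pow_zero, mul_one]
      refine (card_le_card fun w hw => ?_).trans (card_reducedWords_le n)
      exact mem_reducedWords.2 (mem_coveredWords.1 hw).1
    · simp [coveredWords_zero_of_pos V n hf]
  | succ q ih =>
    set b := 2 * Fintype.card α - 1
    set C := 2 * (#V + 2 * (N + 1)) ^ q with hC
    calc #(coveredWords V (q + 1) n f) * b ^ f
        ≤ _ := Nat.mul_le_mul_right _
          ((card_le_card (coveredWords_succ_subset V q n f)).trans (card_union_le _ _))
      _ ≤ #V * (C * b ^ n) + (n + 1) * (2 * (C * b ^ n)) := by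
          rw [add_mul]
          exact add_le_add (card_biUnion_image_append_mul_le hb (fun _ hn f => ih hn f) V hn f)
            (card_biUnion_image₂_append_mul_le (fun _ hn f => ih hn f) hn f)
      _ ≤ #V * (C * b ^ n) + (N + 1) * (2 * (C * b ^ n)) := by gcongr
      _ = 2 * (#V + 2 * (N + 1)) ^ (q + 1) * b ^ n := by rw [hC]; ring

end CoveredWords

section Overlaps

open Finset

variable {α : Type*}

/-- The word `w` has a subword of length `f` that is determined by the letters before it: it
repeats the initial segment of length `f` of `w` at a later place (possibly overlapping it), or it
is inverse to this initial segment and disjoint from it. -/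
def HasOverlap (f : ℕ) (w : List (α × Bool)) : Prop :=
  ∃ c, c + f ≤ w.length ∧ ((0 < c ∧ (w.drop c).take f = w.take f) ∨
    (f ≤ c ∧ (w.drop c).take f = FreeGroup.invRev (w.take f)))

theorem take_append_take_drop_append_drop {β : Type*} (w : List β) (c f : ℕ) :
    w.take c ++ (w.drop c).take f ++ w.drop (c + f) = w := by
  rw [List.append_assoc, ← List.drop_drop, List.take_append_drop, List.take_append_drop]

theorem eq_of_take_drop_eq_take {β : Type*} {w w' : List β} {c f : ℕ} (hc : 0 < c)
    (hw : (w.drop c).take f = w.take f) (hw' : (w'.drop c).take f = w'.take f)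
    (htake : w.take c = w'.take c) (hdrop : w.drop (c + f) = w'.drop (c + f)) : w = w' := by
  have hshift : ∀ {v : List β}, (v.drop c).take f = v.take f →
      ∀ i, i < f → v[c + i]? = v[i]? := fun {v} hv i hi => by
    rw [← List.getElem?_drop, ← List.getElem?_take_of_lt hi, hv, List.getElem?_take_of_lt hi]
  refine List.ext_getElem? fun i => ?_
  induction i using Nat.strong_induction_on with
  | _ i ih =>
    rcases lt_or_ge i c with hi | hi
    · rw [← List.getElem?_take_of_lt hi, htake, List.getElem?_take_of_lt hi]
    obtain ⟨j, rfl⟩ := Nat.exists_eq_add_of_le hi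
    rcases lt_or_ge j f with hj | hj
    · rw [hshift hw j hj, hshift hw' j hj, ih j (by omega)]
    obtain ⟨k, rfl⟩ := Nat.exists_eq_add_of_le hj
    rw [← add_assoc, ← List.getElem?_drop, hdrop, List.getElem?_drop]

theorem eq_of_take_drop_eq_invRev_take {w w' : List (α × Bool)} {c f : ℕ} (hc : f ≤ c)
    (hw : (w.drop c).take f = FreeGroup.invRev (w.take f))
    (hw' : (w'.drop c).take f = FreeGroup.invRev (w'.take f))
    (htake : w.take c = w'.take c) (hdrop : w.drop (c + f) = w'.drop (c + f)) : w = w' := by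
  have htake' : w.take f = w'.take f := by
    rw [← min_eq_left hc, ← List.take_take, htake, List.take_take]
  rw [← take_append_take_drop_append_drop w c f, ← take_append_take_drop_append_drop w' c f,
    hw, hw', htake, htake', hdrop]

theorem eq_nil_of_isSuffix_of_isPrefix_invRev {x v : List (α × Bool)}
    (hx : FreeGroup.IsReduced x) (hsuf : x <:+ v) (hpre : x <+: FreeGroup.invRev v) : x = [] := by
  have hpre' : FreeGroup.invRev x <+: FreeGroup.invRev v := by
    obtain ⟨t, rfl⟩ := hsuf
    rw [FreeGroup.invRev_append]
    exact List.prefix_append _ _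
  exact eq_nil_of_eq_invRev hx
    ((List.prefix_of_prefix_length_le hpre hpre' (by simp)).eq_of_length (by simp))

theorem hasOverlap_of_isPrefix_rotate {w v : List (α × Bool)} {c : ℕ} (hc : 0 < c)
    (hcv : c + v.length ≤ w.length) (h₁ : v <+: w) (h₂ : v <+: w.rotate c) :
    HasOverlap v.length w := by
  rw [List.rotate_eq_drop_append_take (by omega)] at h₂
  have hdrop : v <+: w.drop c := List.prefix_of_prefix_length_le h₂ (List.prefix_append _ _)
    (by rw [List.length_drop]; omega)
  refine ⟨c, hcv, Or.inl ⟨hc, ?_⟩⟩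
  rw [← List.prefix_iff_eq_take.1 hdrop, ← List.prefix_iff_eq_take.1 h₁]

theorem hasOverlap_of_isSuffix_rotate {w v : List (α × Bool)} {c : ℕ}
    (hw : FreeGroup.IsReduced w) (hc : 0 < c) (hcw : c ≤ w.length) (h₁ : v <+: w)
    (h₂ : FreeGroup.invRev v <:+ w.rotate c) : HasOverlap v.length w := by
  have hli : (FreeGroup.invRev v).length = v.length := FreeGroup.invRev_length
  have hlc : (w.take c).length = c := List.length_take_of_le hcw
  have htake : v = w.take v.length := List.prefix_iff_eq_take.1 h₁
  rw [List.rotate_eq_drop_append_take hcw] at h₂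
  have hvc : v.length ≤ c := by
    by_contra! hlt
    have hpre : w.take c <+: FreeGroup.invRev (FreeGroup.invRev v) := by
      rw [FreeGroup.invRev_invRev]
      exact List.prefix_of_prefix_length_le (List.take_prefix _ _) h₁ (by omega)
    have hsuf : w.take c <:+ FreeGroup.invRev v :=
      List.suffix_of_suffix_length_le (List.suffix_append _ _) h₂ (by omega)
    have hnil := eq_nil_of_isSuffix_of_isPrefix_invRev
      (hw.infix (List.take_prefix c w).isInfix) hsuf hpre
    rw [hnil, List.length_nil] at hlc
    omega
  obtain ⟨d, rfl⟩ := Nat.exists_eq_add_of_le' hvc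
  have hinv : FreeGroup.invRev v = (w.drop d).take v.length := by
    have hsuf := List.suffix_of_suffix_length_le h₂ (List.suffix_append _ _) (by omega)
    rwa [List.suffix_iff_eq_drop, hli, hlc, Nat.add_sub_cancel, List.drop_take,
      Nat.add_sub_cancel_left] at hsuf
  refine ⟨d, hcw, Or.inr ⟨?_, by rw [← htake, hinv]⟩⟩
  have hpre : v.drop d <+: FreeGroup.invRev v := by
    rw [hinv, htake, List.drop_take, ← htake]
    exact List.take_prefix_take_left (by omega)
  exact List.drop_eq_nil_iff.1 (eq_nil_of_isSuffix_of_isPrefix_invRev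
    (hw.infix ((List.drop_suffix d v).isInfix.trans h₁.isInfix)) (List.drop_suffix d v) hpre)

theorem hasOverlap_or_of_isRotated {w₁ w₂ v : List (α × Bool)} (h : w₁.IsRotated w₂)
    (hne : w₁ ≠ w₂) (h₁ : v <+: w₁) (h₂ : v <+: w₂) (hv : 2 * v.length ≤ w₁.length) :
    HasOverlap v.length w₁ ∨ HasOverlap v.length w₂ := by
  obtain ⟨c, hc, rfl⟩ := List.isRotated_iff_mod.1 h
  have hc0 : 0 < c := Nat.pos_of_ne_zero fun h => hne (by rw [h, List.rotate_zero])
  have hcn : c < w₁.length := hc.lt_of_ne fun h => hne (by rw [h, List.rotate_length])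
  rcases Nat.le_total (c + v.length) w₁.length with hle | hle
  · exact Or.inl (hasOverlap_of_isPrefix_rotate hc0 hle h₁ h₂)
  · refine Or.inr (hasOverlap_of_isPrefix_rotate (c := w₁.length - c) (by omega) ?_ h₂ ?_)
    · rw [List.length_rotate]
      omega
    · rwa [List.rotate_rotate, Nat.add_sub_cancel' hc, List.rotate_length]

theorem hasOverlap_of_isRotated_invRev {w₁ w₂ v : List (α × Bool)}
    (hw₁ : FreeGroup.IsReduced w₁) (h : w₁.IsRotated (FreeGroup.invRev w₂)) (hne : w₁ ≠ w₂)
    (h₁ : v <+: w₁) (h₂ : v <+: w₂) : HasOverlap v.length w₁ := by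
  have hw₁0 : 0 < w₁.length := by
    refine List.length_pos_of_ne_nil fun hnil => hne ?_
    rw [hnil, List.isRotated_nil_iff'] at h
    rw [hnil, ← FreeGroup.invRev_invRev (L₁ := w₂), ← h, FreeGroup.invRev_empty]
  have hsuf : FreeGroup.invRev v <:+ FreeGroup.invRev w₂ := by
    obtain ⟨t, rfl⟩ := h₂
    rw [FreeGroup.invRev_append]
    exact List.suffix_append _ _
  obtain ⟨c, hc, hcw⟩ := List.isRotated_iff_mod.1 h
  rcases Nat.eq_zero_or_pos c with rfl | hc0
  · refine hasOverlap_of_isSuffix_rotate hw₁ hw₁0 le_rfl h₁ ?_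
    rwa [List.rotate_length, ← List.rotate_zero w₁, hcw]
  · exact hasOverlap_of_isSuffix_rotate hw₁ hc0 hc h₁ (hcw ▸ hsuf)

variable [Fintype α] [DecidableEq α]

theorem card_mul_pow_le_of_injOn_take_drop {S : Finset (List (α × Bool))} {n c f : ℕ}
    (hcf : c + f ≤ n) (hS : S ⊆ reducedWords α n)
    (hinj : Set.InjOn (fun w => (w.take c, w.drop (c + f))) (S : Set (List (α × Bool)))) :
    #S * (2 * Fintype.card α - 1) ^ f ≤ 4 * (2 * Fintype.card α - 1) ^ n := by
  set b := 2 * Fintype.card α - 1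
  have hmaps : Set.MapsTo (fun w => (w.take c, w.drop (c + f))) (S : Set (List (α × Bool)))
      (reducedWords α c ×ˢ reducedWords α (n - (c + f)) : Finset _) := fun w hw => by
    obtain ⟨hlen, hred⟩ := mem_reducedWords.1 (hS hw)
    refine mem_coe.2 (mem_product.2 ⟨mem_reducedWords.2 ⟨?_, ?_⟩, mem_reducedWords.2 ⟨?_, ?_⟩⟩)
    · rw [List.length_take]; omega
    · exact hred.infix (List.take_prefix _ _).isInfix
    · rw [List.length_drop, hlen]
    · exact hred.infix (List.drop_suffix _ _).isInfix
  calc #S * b ^ f ≤ (2 * b ^ c * (2 * b ^ (n - (c + f)))) * b ^ f := by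
        refine Nat.mul_le_mul_right _ ((card_le_card_of_injOn _ hmaps hinj).trans ?_)
        rw [card_product]
        exact Nat.mul_le_mul (card_reducedWords_le c) (card_reducedWords_le _)
    _ = 4 * (b ^ (c + f) * b ^ (n - (c + f))) := by ring
    _ = 4 * b ^ n := by rw [← pow_add, Nat.add_sub_cancel' hcf]

open Classical in
/-- The reduced words of length `n` with an overlap of length `f`. -/
noncomputable def overlapWords (α : Type*) [Fintype α] [DecidableEq α] (n f : ℕ) :
    Finset (List (α × Bool)) :=
  {w ∈ reducedWords α n | HasOverlap f w}

theorem mem_overlapWords {n f : ℕ} {w : List (α × Bool)} :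
    w ∈ overlapWords α n f ↔ (w.length = n ∧ FreeGroup.IsReduced w) ∧ HasOverlap f w := by
  classical rw [overlapWords, mem_filter, mem_reducedWords]

theorem card_overlapWords_mul_le (n f : ℕ) :
    #(overlapWords α n f) * (2 * Fintype.card α - 1) ^ f
      ≤ (n + 1) * (8 * (2 * Fintype.card α - 1) ^ n) := by
  classical
  let repeating : ℕ → Finset (List (α × Bool)) := fun c =>
    {w ∈ reducedWords α n | (w.drop c).take f = w.take f}
  let inverting : ℕ → Finset (List (α × Bool)) := fun c =>
    {w ∈ reducedWords α n | (w.drop c).take f = FreeGroup.invRev (w.take f)}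
  have hsub : overlapWords α n f ⊆ {c ∈ range (n + 1) | c + f ≤ n}.biUnion fun c =>
      (if 0 < c then repeating c else ∅) ∪ (if f ≤ c then inverting c else ∅) := by
    intro w hw
    obtain ⟨hmem, c, hc, h⟩ := mem_overlapWords.1 hw
    refine mem_biUnion.2 ⟨c, mem_filter.2 ⟨Finset.mem_range.2 ?_, ?_⟩, mem_union.2 ?_⟩
    · omega
    · omega
    · refine h.imp (fun h => ?_) fun h => ?_ <;> rw [if_pos h.1]
      · exact mem_filter.2 ⟨mem_reducedWords.2 hmem, h.2⟩
      · exact mem_filter.2 ⟨mem_reducedWords.2 hmem, h.2⟩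
  refine (Nat.mul_le_mul_right _ (card_le_card hsub)).trans ((card_biUnion_mul_le
    (C := 8 * (2 * Fintype.card α - 1) ^ n) fun c hc => ?_).trans (Nat.mul_le_mul_right _
      ((card_filter_le _ _).trans (card_range _).le)))
  have hcf := (mem_filter.1 hc).2
  refine (Nat.mul_le_mul_right _ (card_union_le _ _)).trans ?_
  rw [add_mul, show (8 : ℕ) = 4 + 4 from rfl, add_mul]
  refine add_le_add ?_ ?_ <;> split_ifs with h <;> try simp
  · exact card_mul_pow_le_of_injOn_take_drop hcf (filter_subset _ _) fun w hw w' hw' heq =>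
      eq_of_take_drop_eq_take h (mem_filter.1 hw).2 (mem_filter.1 hw').2
        (Prod.mk.inj heq).1 (Prod.mk.inj heq).2
  · exact card_mul_pow_le_of_injOn_take_drop hcf (filter_subset _ _) fun w hw w' hw' heq =>
      eq_of_take_drop_eq_invRev_take h (mem_filter.1 hw).2 (mem_filter.1 hw').2
        (Prod.mk.inj heq).1 (Prod.mk.inj heq).2

end Overlaps

section Concatenations

open Finset

variable {α : Type*} [DecidableEq α]

/-- The words that are a product of `q` words of `D`, followed by a word of `T`. -/
def concatenations (D T : Finset (List α)) : ℕ → Finset (List α)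
  | 0 => T
  | q + 1 => image₂ (· ++ ·) D (concatenations D T q)

theorem card_concatenations {D T : Finset (List α)} {l : ℕ} (hD : ∀ u ∈ D, u.length = l) (q : ℕ) :
    #(concatenations D T q) = #D ^ q * #T := by
  induction q with
  | zero => simp [concatenations]
  | succ q ih =>
    rw [concatenations, card_image₂_iff.2, ih, pow_succ', mul_assoc]
    rintro ⟨u, v⟩ h ⟨u', v'⟩ h' heq
    have hu := hD u (Set.mem_prod.1 h).1
    have hu' := hD u' (Set.mem_prod.1 h').1
    exact Prod.ext_iff.2 (List.append_inj heq (hu.trans hu'.symm))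

theorem exists_flatten_isPrefix_of_mem_concatenations {D T : Finset (List α)} {q : ℕ} {w : List α}
    (hw : w ∈ concatenations D T q) :
    ∃ L : List (List α), L.length = q ∧ (∀ u ∈ L, u ∈ D) ∧ L.flatten <+: w := by
  induction q generalizing w with
  | zero => exact ⟨[], rfl, by simp, by simp⟩
  | succ q ih =>
    obtain ⟨u, hu, v, hv, rfl⟩ := mem_image₂.1 hw
    obtain ⟨L, hL, hLD, hpre⟩ := ih hv
    refine ⟨u :: L, by simp [hL], List.forall_mem_cons.2 ⟨hu, hLD⟩, ?_⟩
    rwa [List.flatten_cons, List.prefix_append_right_inj]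

theorem concatenations_subset_anchoredWords [Fintype α] {x : α × Bool}
    {D T : Finset (List (α × Bool))} {l k : ℕ} (hD : D ⊆ anchoredWords x l)
    (hT : T ⊆ anchoredWords x k) (q : ℕ) :
    concatenations D T q ⊆ anchoredWords x (q * l + k) := by
  induction q with
  | zero => simpa [concatenations] using hT
  | succ q ih =>
    rw [concatenations]
    refine image₂_subset_iff.2 fun u hu v hv => mem_anchoredWords.2 ?_
    obtain ⟨hul, hua⟩ := mem_anchoredWords.1 (hD hu)
    obtain ⟨hvl, hva⟩ := mem_anchoredWords.1 (ih hv)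
    exact ⟨by rw [List.length_append, hul, hvl]; ring, hua.append hva⟩

end Concatenations

section Relators

open Finset

variable {m : ℕ}

theorem mem_symmetrized_iff {R : Set (GWord m)} {w : GWord m} :
    w ∈ symmetrized R ↔ ∃ r ∈ R, w ∈ symmetrized {r} := by
  simp [symmetrized]

theorem mem_symmetrized_singleton {r w : GWord m} :
    w ∈ symmetrized {r} ↔ w.IsRotated r ∨ w.IsRotated (FreeGroup.invRev r) := by
  simp [symmetrized]

theorem mem_symmetrized_singleton_comm {r w : GWord m} :
    w ∈ symmetrized {r} ↔ r ∈ symmetrized {w} := by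
  rw [mem_symmetrized_singleton, mem_symmetrized_singleton, isRotated_invRev_comm,
    List.isRotated_comm, List.isRotated_comm (l := FreeGroup.invRev w)]

theorem mem_symmetrized_of_isRotated {r w v : GWord m} (h : v.IsRotated w)
    (hw : w ∈ symmetrized {r}) : v ∈ symmetrized {r} := by
  rw [mem_symmetrized_singleton] at hw ⊢
  exact hw.imp h.trans h.trans

theorem isRotated_or_of_mem_symmetrized {r w v : GWord m} (hw : w ∈ symmetrized {r})
    (hv : v ∈ symmetrized {r}) : w.IsRotated v ∨ w.IsRotated (FreeGroup.invRev v) := by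
  rw [mem_symmetrized_singleton] at hw hv
  rcases hw with hw | hw <;> rcases hv with hv | hv
  · exact Or.inl (hw.trans hv.symm)
  · exact Or.inr (hw.trans (isRotated_invRev_comm.1 hv).symm)
  · exact Or.inr (hw.trans (isRotated_invRev hv).symm)
  · exact Or.inl (hw.trans hv.symm)

theorem length_eq_of_mem_symmetrized {r w : GWord m} (hw : w ∈ symmetrized {r}) :
    w.length = r.length := by
  rcases mem_symmetrized_singleton.1 hw with h | h
  · exact h.perm.length_eq
  · simpa using h.perm.length_eq

theorem isReduced_of_mem_symmetrized {r w : GWord m} (h : FreeGroup.IsCyclicallyReduced r)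
    (hw : w ∈ symmetrized {r}) : FreeGroup.IsReduced w := by
  rcases mem_symmetrized_singleton.1 hw with hw | hw
  · exact (isCyclicallyReduced_of_isRotated h hw.symm).isReduced
  · exact (isCyclicallyReduced_of_isRotated (isCyclicallyReduced_invRev h) hw.symm).isReduced

/-- The symmetrized set of relators of a finite set of relators, as a finite set. -/
def symmetrization (T : Finset (GWord m)) : Finset (GWord m) :=
  T.biUnion fun r => (range (r.length + 1)).image r.rotate ∪
    (range (r.length + 1)).image (FreeGroup.invRev r).rotate

theorem mem_symmetrization {T : Finset (GWord m)} {w : GWord m} :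
    w ∈ symmetrization T ↔ ∃ r ∈ T, w ∈ symmetrized {r} := by
  have hrot : ∀ r : GWord m, w.IsRotated r ↔ ∃ n < r.length + 1, r.rotate n = w := fun r => by
    rw [List.isRotated_comm, List.isRotated_iff_mod]
    simp only [Nat.lt_succ_iff]
  simp only [symmetrization, mem_biUnion, mem_union, mem_image, Finset.mem_range,
    mem_symmetrized_singleton]
  refine exists_congr fun r => and_congr_right fun _ => ?_
  rw [hrot r, hrot (FreeGroup.invRev r), FreeGroup.invRev_length]

theorem card_symmetrization_le {T : Finset (GWord m)} {ℓ : ℕ} (h : ∀ r ∈ T, r.length ≤ ℓ) :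
    #(symmetrization T) ≤ #T * (2 * (ℓ + 1)) := by
  refine card_biUnion_le_card_mul _ _ _ fun r hr => (card_union_le _ _).trans ?_
  rw [two_mul]
  refine add_le_add ?_ ?_ <;>
    exact card_image_le.trans ((card_range _).le.trans (Nat.succ_le_succ (h r hr)))

/-- The cyclic subwords of the words in `T` and of their inverses. -/
def cyclicSubwords (T : Finset (GWord m)) : Finset (GWord m) :=
  (symmetrization T).biUnion fun w => w.inits.toFinset

theorem mem_cyclicSubwords {T : Finset (GWord m)} {u : GWord m} :
    u ∈ cyclicSubwords T ↔ ∃ r ∈ T, ∃ w ∈ symmetrized {r}, u <+: w := by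
  simp only [cyclicSubwords, mem_biUnion, mem_symmetrization, List.mem_toFinset, List.mem_inits]
  constructor
  · rintro ⟨w, ⟨r, hr, hw⟩, hu⟩
    exact ⟨r, hr, w, hw, hu⟩
  · rintro ⟨r, hr, w, hw, hu⟩
    exact ⟨w, ⟨r, hr, hw⟩, hu⟩

theorem card_cyclicSubwords_le {T : Finset (GWord m)} {ℓ : ℕ} (h : ∀ r ∈ T, r.length ≤ ℓ) :
    #(cyclicSubwords T) ≤ #T * (2 * (ℓ + 1)) * (ℓ + 1) := by
  refine (card_biUnion_le_card_mul _ _ (ℓ + 1) fun w hw => ?_).trans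
    (Nat.mul_le_mul_right _ (card_symmetrization_le h))
  obtain ⟨r, hr, hw⟩ := mem_symmetrization.1 hw
  refine (List.toFinset_card_le _).trans ?_
  rw [List.length_inits, length_eq_of_mem_symmetrized hw]
  exact Nat.succ_le_succ (h r hr)

theorem exists_hasOverlap_of_isPiece {r u : GWord m} {f : ℕ}
    (hr : FreeGroup.IsCyclicallyReduced r) (hu : IsPiece {r} u) (hf : f ≤ u.length)
    (hfr : 2 * f ≤ r.length) : ∃ w ∈ symmetrized {r}, HasOverlap f w := by
  obtain ⟨w₁, h₁, w₂, h₂, hne, hu₁, hu₂⟩ := hu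
  have hv₁ := (List.take_prefix f u).trans hu₁
  have hv₂ := (List.take_prefix f u).trans hu₂
  rw [← List.length_take_of_le hf]
  rcases isRotated_or_of_mem_symmetrized h₁ h₂ with h | h
  · refine (hasOverlap_or_of_isRotated h hne hv₁ hv₂ ?_).elim (⟨w₁, h₁, ·⟩) (⟨w₂, h₂, ·⟩)
    rwa [List.length_take_of_le hf, length_eq_of_mem_symmetrized h₁]
  · have hred := isReduced_of_mem_symmetrized hr h₁
    exact ⟨w₁, h₁, hasOverlap_of_isRotated_invRev hred h hne hv₁ hv₂⟩

theorem isPiece_singleton_or_mem_cyclicSubwords {R : Set (GWord m)} {r u w : GWord m}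
    (hu : IsPiece R u) (hw : w ∈ symmetrized {r}) (huw : u <:+: w) :
    IsPiece {r} u ∨ ∃ r' ∈ R \ {r}, u ∈ cyclicSubwords {r'} := by
  obtain ⟨ρ, hρw, huρ⟩ := exists_isRotated_isPrefix_of_isInfix huw
  have hρ := mem_symmetrized_of_isRotated hρw hw
  have hother : ∀ v ∈ symmetrized R, u <+: v → ρ ≠ v →
      IsPiece {r} u ∨ ∃ r' ∈ R \ {r}, u ∈ cyclicSubwords {r'} := by
    intro v hv huv hne
    obtain ⟨r', hr', hv'⟩ := mem_symmetrized_iff.1 hv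
    by_cases heq : r' = r
    · exact Or.inl ⟨ρ, hρ, v, heq ▸ hv', hne, huρ, huv⟩
    · exact Or.inr ⟨r', ⟨hr', heq⟩, mem_cyclicSubwords.2 ⟨r', by simp, v, hv', huv⟩⟩
  obtain ⟨w₁, h₁, w₂, h₂, hne, hu₁, hu₂⟩ := hu
  by_cases hρ₁ : ρ = w₁
  · exact hother w₂ h₂ hu₂ (hρ₁ ▸ hne)
  · exact hother w₁ h₁ hu₁ hρ₁

theorem exists_finset_mul_length_flatten_add_le {R : Set (GWord m)} {n N : ℕ}
    {L : List (GWord m)}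
    (hL : ∀ u ∈ L, N * u.length ≤ n ∨ ∃ r ∈ R, u ∈ cyclicSubwords {r}) :
    ∃ T : Finset (GWord m), (T : Set (GWord m)) ⊆ R ∧ #T ≤ L.length ∧
      N * L.flatten.length + #T * n ≤ N * totalLengthIn (cyclicSubwords T) L + L.length * n := by
  have hlong : ∀ u, u ∈ L ∧ n < N * u.length → ∃ r ∈ R, u ∈ cyclicSubwords {r} :=
    fun u hu => (hL u hu.1).resolve_left hu.2.not_ge
  choose! g hgR hg using hlong
  let long := L.filter (n < N * ·.length)
  have hmem : ∀ {u}, u ∈ long.toFinset ↔ u ∈ L ∧ n < N * u.length := by simp [long]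
  have hcard : #(long.toFinset.image g) ≤ L.countP (n < N * ·.length) :=
    card_image_le.trans ((List.toFinset_card_le _).trans List.countP_eq_length_filter.ge)
  refine ⟨long.toFinset.image g, ?_, hcard.trans List.countP_le_length, ?_⟩
  · rw [coe_image, Set.image_subset_iff]
    exact fun u hu => hgR u (hmem.1 hu)
  refine (Nat.add_le_add_left (Nat.mul_le_mul_right n hcard) _).trans
    (mul_length_flatten_add_le fun u hu => ?_)
  refine or_iff_not_imp_left.2 fun hu' => ?_
  have hul : u ∈ L ∧ n < N * u.length := ⟨hu, not_le.1 hu'⟩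
  obtain ⟨r, hr, hw⟩ := mem_cyclicSubwords.1 (hg u hul)
  exact mem_cyclicSubwords.2 ⟨g u, mem_image_of_mem g (hmem.2 hul), mem_singleton.1 hr ▸ hw⟩

/-- The words of length at most `ℓ` with a cyclic permutation, possibly after inversion, in which
the proportion `(#T + 1) / (2 * p + 2)` of the letters is not free: they belong to cyclic subwords
of relators in `T`, or they overlap an initial segment. Every violation of `B(2p)` comes from a
set `T` of at most `p` relators together with one more relator of this kind. -/
noncomputable def badRelators (p ℓ : ℕ) (T : Finset (GWord m)) : Finset (GWord m) :=
  (range (ℓ + 1)).biUnion fun n => symmetrization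
    (coveredWords (cyclicSubwords T) p n ((#T + 1) * n / (2 * p + 2)) ∪
      overlapWords (Fin m) n ((#T + 1) * n / (2 * p + 2)))

theorem mem_badRelators {p ℓ : ℕ} {T : Finset (GWord m)} {r w : GWord m}
    (hr : r ∈ relatorBall m ℓ) (hw : w ∈ symmetrized {r})
    (h : (∃ L : List (GWord m), L.length ≤ p ∧ L.flatten <+: w ∧
        (#T + 1) * r.length / (2 * p + 2) ≤ totalLengthIn (cyclicSubwords T) L) ∨
      HasOverlap ((#T + 1) * r.length / (2 * p + 2)) w) : r ∈ badRelators p ℓ T := by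
  have hw' := And.intro (length_eq_of_mem_symmetrized hw) (isReduced_of_mem_symmetrized hr.1 hw)
  refine mem_biUnion.2 ⟨r.length, Finset.mem_range.2 (Nat.lt_succ_of_le hr.2),
    mem_symmetrization.2 ⟨w, mem_union.2 ?_, mem_symmetrized_singleton_comm.1 hw⟩⟩
  exact h.imp (fun h => mem_coveredWords.2 ⟨hw', h⟩) fun h => mem_overlapWords.2 ⟨hw', h⟩

theorem mem_badRelators_empty_of_isPiece {p ℓ : ℕ} {r u : GWord m} (hr : r ∈ relatorBall m ℓ)
    (hu : IsPiece {r} u) (hlen : r.length < (2 * p + 2) * u.length) :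
    r ∈ badRelators p ℓ ∅ := by
  have hhalf : 2 * (r.length / (2 * p + 2)) ≤ r.length :=
    (Nat.mul_le_mul_right _ (by omega)).trans (Nat.mul_div_le r.length (2 * p + 2))
  obtain ⟨w, hw, hov⟩ :=
    exists_hasOverlap_of_isPiece hr.1 hu (Nat.div_le_of_le_mul hlen.le) hhalf
  refine mem_badRelators hr hw (Or.inr ?_)
  rwa [card_empty, zero_add, one_mul]

theorem exists_mem_badRelators_of_not_satisfiesB {p ℓ : ℕ} {R : Set (GWord m)}
    (hR : R ⊆ relatorBall m ℓ) (h : ¬ SatisfiesB p R) :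
    ∃ T : Finset (GWord m), (T : Set (GWord m)) ⊆ R ∧ #T ≤ p ∧
      ∃ r ∈ badRelators p ℓ T, r ∈ R ∧ r ∉ T := by
  rw [SatisfiesB] at h
  push Not at h
  obtain ⟨w, hw, s, hsw, ⟨L, hLp, hL, rfl⟩, hs⟩ := h
  obtain ⟨r, hrR, hwr⟩ := mem_symmetrized_iff.1 hw
  by_cases hself : ∃ u ∈ L, IsPiece {r} u ∧ r.length < (2 * p + 2) * u.length
  · obtain ⟨u, -, hu, hul⟩ := hself
    exact ⟨∅, by simp, by simp, r, mem_badRelators_empty_of_isPiece (hR hrR) hu hul, hrR, by simp⟩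
  push Not at hself
  have hcover : ∀ u ∈ L, (2 * p + 2) * u.length ≤ r.length ∨
      ∃ r' ∈ R \ {r}, u ∈ cyclicSubwords {r'} := fun u hu =>
    (isPiece_singleton_or_mem_cyclicSubwords (hL u hu) hwr
      ((List.infix_of_mem_flatten hu).trans hsw.isInfix)).imp_left (hself u hu)
  obtain ⟨T, hTR, hTL, hle⟩ := exists_finset_mul_length_flatten_add_le hcover
  refine ⟨T, hTR.trans Set.sdiff_subset, hTL.trans hLp, r,
    mem_badRelators (hR hrR) hwr (Or.inl ⟨L, hLp, hsw, Nat.div_le_of_le_mul ?_⟩), hrR,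
    fun hrT => (hTR hrT).2 rfl⟩
  rw [length_eq_of_mem_symmetrized hwr] at hs
  have hhalf : (p + 1) * r.length ≤ (2 * p + 2) * L.flatten.length := by
    calc (p + 1) * r.length ≤ (p + 1) * (2 * L.flatten.length) := Nat.mul_le_mul_left _ hs
      _ = _ := by ring
  have hLp' : L.length * r.length ≤ p * r.length := Nat.mul_le_mul_right _ hLp
  linarith

theorem card_coveredWords_union_overlapWords_mul_le [NeZero m] {V : Finset (GWord m)} {p ℓ n : ℕ}
    (hV : #V ≤ p * (2 * (ℓ + 1)) * (ℓ + 1)) (hn : n ≤ ℓ) (f : ℕ) :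
    #(coveredWords V p n f ∪ overlapWords (Fin m) n f) * (2 * m - 1) ^ f
      ≤ (2 * (2 * p + 2) ^ p + 8) * (ℓ + 1) ^ (2 * p + 1) * (2 * m - 1) ^ n := by
  have hcov := card_coveredWords_mul_le V p hn f
  have hover := card_overlapWords_mul_le (α := Fin m) n f
  rw [Fintype.card_fin] at hcov hover
  have hbase : #V + 2 * (ℓ + 1) ≤ (2 * p + 2) * (ℓ + 1) ^ 2 := by nlinarith
  have hcoef : 2 * (#V + 2 * (ℓ + 1)) ^ p + (n + 1) * 8
      ≤ (2 * (2 * p + 2) ^ p + 8) * (ℓ + 1) ^ (2 * p + 1) := by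
    calc 2 * (#V + 2 * (ℓ + 1)) ^ p + (n + 1) * 8
        ≤ 2 * ((2 * p + 2) * (ℓ + 1) ^ 2) ^ p + (ℓ + 1) * 8 := by gcongr
      _ = 2 * (2 * p + 2) ^ p * (ℓ + 1) ^ (2 * p) + 8 * (ℓ + 1) ^ 1 := by
          rw [mul_pow, ← pow_mul]
          ring
      _ ≤ 2 * (2 * p + 2) ^ p * (ℓ + 1) ^ (2 * p + 1) + 8 * (ℓ + 1) ^ (2 * p + 1) := by
          gcongr <;> omega
      _ = _ := by ring
  calc _ ≤ (#(coveredWords V p n f) + #(overlapWords (Fin m) n f)) * (2 * m - 1) ^ f :=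
        Nat.mul_le_mul_right _ (card_union_le _ _)
    _ ≤ (2 * (#V + 2 * (ℓ + 1)) ^ p + (n + 1) * 8) * (2 * m - 1) ^ n := by
        rw [add_mul, add_mul, mul_assoc (n + 1)]
        exact add_le_add hcov hover
    _ ≤ _ := Nat.mul_le_mul_right _ hcoef

theorem pow_le_rpow_mul_pow {b t : ℝ} (hb : 1 ≤ b) (ht : t ≤ 1) {ℓ n f : ℕ} (hn : n ≤ ℓ)
    (hf : t * n ≤ f + 1) : b ^ n ≤ b ^ (1 + ℓ * (1 - t)) * b ^ f := by
  have hn' : (n : ℝ) ≤ ℓ := by exact_mod_cast hn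
  rw [← Real.rpow_natCast, ← Real.rpow_natCast, ← Real.rpow_add (by linarith)]
  refine Real.rpow_le_rpow_of_exponent_le hb ?_
  nlinarith [mul_le_mul_of_nonneg_right hn' (sub_nonneg.2 ht)]

theorem card_coveredWords_cyclicSubwords_union_overlapWords_le (hm : 0 < m) {p ℓ n : ℕ}
    {T : Finset (GWord m)} (hT : ∀ r ∈ T, r.length ≤ ℓ) (hTp : #T ≤ p) (hn : n ≤ ℓ) :
    (#(coveredWords (cyclicSubwords T) p n ((#T + 1) * n / (2 * p + 2)) ∪
      overlapWords (Fin m) n ((#T + 1) * n / (2 * p + 2))) : ℝ) ≤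
      (2 * (2 * p + 2) ^ p + 8) * (ℓ + 1) ^ (2 * p + 1) *
        ((2 * m - 1 : ℕ) : ℝ) ^ (1 + ℓ * (1 - (#T + 1) / (2 * p + 2)) : ℝ) := by
  have : NeZero m := ⟨hm.ne'⟩
  have hb : (1 : ℝ) ≤ (2 * m - 1 : ℕ) := by exact_mod_cast (by omega : 1 ≤ 2 * m - 1)
  have ht : ((#T : ℝ) + 1) / (2 * p + 2) ≤ 1 := by
    rw [div_le_one (by positivity)]
    have : (#T : ℝ) ≤ p := by exact_mod_cast hTp
    linarith
  have hfn : ((#T : ℝ) + 1) / (2 * p + 2) * n ≤ ((#T + 1) * n / (2 * p + 2) : ℕ) + 1 := by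
    have hlt : (#T + 1) * n < ((#T + 1) * n / (2 * p + 2) + 1) * (2 * p + 2) :=
      Nat.lt_mul_of_div_lt (Nat.lt_succ_self _) (by omega)
    rw [div_mul_eq_mul_div, div_le_iff₀ (by positivity)]
    exact_mod_cast hlt.le
  have hV := (card_cyclicSubwords_le hT).trans
    (Nat.mul_le_mul_right (ℓ + 1) (Nat.mul_le_mul_right (2 * (ℓ + 1)) hTp))
  have hcount := (Nat.cast_le (α := ℝ)).2 (card_coveredWords_union_overlapWords_mul_le hV hn
    ((#T + 1) * n / (2 * p + 2)))
  rw [Nat.cast_mul, Nat.cast_mul, Nat.cast_pow, Nat.cast_pow (2 * m - 1) n] at hcount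
  refine le_of_mul_le_mul_right (hcount.trans ?_)
    (by positivity : 0 < ((2 * m - 1 : ℕ) : ℝ) ^ ((#T + 1) * n / (2 * p + 2)))
  rw [mul_assoc]
  push_cast
  exact mul_le_mul_of_nonneg_left (pow_le_rpow_mul_pow hb ht hn hfn) (by positivity)

/-- An upper bound for the number of bad relators for a set of `k` relators. -/
noncomputable def badRelatorsBound (m p k ℓ : ℕ) : ℝ :=
  2 * (2 * (2 * p + 2) ^ p + 8) * (ℓ + 1) ^ (2 * p + 3) *
    ((2 * m - 1 : ℕ) : ℝ) ^ (1 + ℓ * (1 - (k + 1) / (2 * p + 2)) : ℝ)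

theorem card_badRelators_le (hm : 0 < m) {p ℓ : ℕ} {T : Finset (GWord m)}
    (hT : ∀ r ∈ T, r.length ≤ ℓ) (hTp : #T ≤ p) :
    (#(badRelators p ℓ T) : ℝ) ≤ badRelatorsBound m p #T ℓ := by
  set M : ℝ := (2 * (2 * p + 2) ^ p + 8) * (ℓ + 1) ^ (2 * p + 1) *
    ((2 * m - 1 : ℕ) : ℝ) ^ (1 + ℓ * (1 - (#T + 1) / (2 * p + 2)) : ℝ)
  have hcard : ∀ n ∈ range (ℓ + 1), (#(symmetrization
      (coveredWords (cyclicSubwords T) p n ((#T + 1) * n / (2 * p + 2)) ∪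
        overlapWords (Fin m) n ((#T + 1) * n / (2 * p + 2)))) : ℝ) ≤ M * (2 * (ℓ + 1)) := by
    intro n hn
    have hnℓ : n ≤ ℓ := Nat.lt_succ_iff.1 (Finset.mem_range.1 hn)
    have hlen : ∀ r ∈ coveredWords (cyclicSubwords T) p n ((#T + 1) * n / (2 * p + 2)) ∪
        overlapWords (Fin m) n ((#T + 1) * n / (2 * p + 2)), r.length ≤ ℓ :=
      fun r hr => (mem_union.1 hr).elim (fun hr => (mem_coveredWords.1 hr).1.1.trans_le hnℓ)
        fun hr => (mem_overlapWords.1 hr).1.1.trans_le hnℓ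
    refine (Nat.cast_le.2 (card_symmetrization_le hlen)).trans ?_
    push_cast
    exact mul_le_mul_of_nonneg_right
      (card_coveredWords_cyclicSubwords_union_overlapWords_le hm hT hTp hnℓ) (by positivity)
  calc (#(badRelators p ℓ T) : ℝ) ≤ ∑ n ∈ range (ℓ + 1), (#(symmetrization
        (coveredWords (cyclicSubwords T) p n ((#T + 1) * n / (2 * p + 2)) ∪
          overlapWords (Fin m) n ((#T + 1) * n / (2 * p + 2)))) : ℝ) := by
        exact_mod_cast card_biUnion_le
    _ ≤ #(range (ℓ + 1)) • (M * (2 * (ℓ + 1))) := sum_le_card_nsmul _ _ _ hcard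
    _ = badRelatorsBound m p #T ℓ := by
        rw [card_range, nsmul_eq_mul, badRelatorsBound]
        push_cast
        ring

end Relators

section RelatorBall

open Finset

variable {m : ℕ}

noncomputable instance relatorBallFintype (m ℓ : ℕ) : Fintype (relatorBall m ℓ) :=
  Fintype.ofFinite _

theorem one_lt_two_mul_sub_one (hm : 2 ≤ m) : (1 : ℝ) < (2 * m - 1 : ℕ) := by
  exact_mod_cast (by omega : 1 < 2 * m - 1)

theorem card_relatorBall_le (hm : 2 ≤ m) (ℓ : ℕ) :
    (Fintype.card (relatorBall m ℓ) : ℝ) ≤ 4 * ((2 * m - 1 : ℕ) : ℝ) ^ ℓ := by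
  have hsub : (relatorBall m ℓ).toFinset ⊆
      (range (ℓ + 1)).biUnion (reducedWords (Fin m)) := fun w hw => by
    have hw' := Set.mem_toFinset.1 hw
    exact mem_biUnion.2 ⟨w.length, Finset.mem_range.2 (Nat.lt_succ_of_le hw'.2),
      mem_reducedWords.2 ⟨rfl, hw'.1.isReduced⟩⟩
  have hgeom : ∑ k ∈ range ℓ, (2 * m - 1) ^ k < (2 * m - 1) ^ ℓ :=
    Nat.geomSum_lt (by omega) fun k hk => Finset.mem_range.1 hk
  have hcard : Fintype.card (relatorBall m ℓ) ≤ 4 * (2 * m - 1) ^ ℓ := by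
    calc Fintype.card (relatorBall m ℓ) = #(relatorBall m ℓ).toFinset :=
          (Set.toFinset_card _).symm
      _ ≤ ∑ k ∈ range (ℓ + 1), #(reducedWords (Fin m) k) :=
          (card_le_card hsub).trans card_biUnion_le
      _ ≤ ∑ k ∈ range (ℓ + 1), 2 * (2 * m - 1) ^ k := sum_le_sum fun k _ => by
          simpa only [Fintype.card_fin] using card_reducedWords_le (α := Fin m) k
      _ = 2 * (∑ k ∈ range ℓ, (2 * m - 1) ^ k + (2 * m - 1) ^ ℓ) := by
          rw [← mul_sum, sum_range_succ]
      _ ≤ 4 * (2 * m - 1) ^ ℓ := by omega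
  exact_mod_cast hcard

theorem anchoredWords_subset_relatorBall {x : Fin m × Bool} {k ℓ : ℕ} (hk : k ≤ ℓ) :
    (anchoredWords x k : Set (GWord m)) ⊆ relatorBall m ℓ := fun _ hw =>
  have hw' := mem_anchoredWords.1 (mem_coe.1 hw)
  ⟨hw'.2.isCyclicallyReduced, hw'.1.trans_le hk⟩

theorem rpow_le_card_anchoredWords (hm : 2 ≤ m) (x : Fin m × Bool) {k : ℕ} (hk : 2 ≤ k) :
    ((2 * m - 1 : ℕ) : ℝ) ^ ((k : ℝ) - 2) ≤ #(anchoredWords x k) := by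
  obtain ⟨k, rfl⟩ := Nat.exists_eq_add_of_le' hk
  have h := pow_le_card_anchoredWords (α := Fin m) (by rwa [Fintype.card_fin]) x k
  rw [Fintype.card_fin] at h
  rw [Nat.cast_add, Nat.cast_ofNat, add_sub_cancel_right, Real.rpow_natCast]
  exact_mod_cast h

theorem rpow_le_card_relatorBall (hm : 2 ≤ m) {ℓ : ℕ} (hℓ : 2 ≤ ℓ) :
    ((2 * m - 1 : ℕ) : ℝ) ^ ((ℓ : ℝ) - 2) ≤ Fintype.card (relatorBall m ℓ) := by
  refine (rpow_le_card_anchoredWords hm ⟨⟨0, by omega⟩, true⟩ hℓ).trans ?_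
  rw [← Set.toFinset_card]
  exact_mod_cast card_le_card fun w hw =>
    Set.mem_toFinset.2 (anchoredWords_subset_relatorBall le_rfl (mem_coe.2 hw))

theorem tendsto_card_relatorBall (hm : 2 ≤ m) :
    Tendsto (fun ℓ => (Fintype.card (relatorBall m ℓ) : ℝ)) atTop atTop :=
  tendsto_atTop_mono' atTop
    ((eventually_ge_atTop 2).mono fun _ => rpow_le_card_relatorBall hm)
    ((tendsto_rpow_atTop_of_base_gt_one _ (one_lt_two_mul_sub_one hm)).comp
      (tendsto_atTop_add_const_right _ _ tendsto_natCast_atTop_atTop))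

end RelatorBall

section Density

variable {E : Type*} [Fintype E] {A : Set E} {c : ℝ}

theorem ncard_le_rpow_of_subsetDensity_lt (hE : 2 ≤ Fintype.card E)
    (h : subsetDensity A < (c : EReal)) : (A.ncard : ℝ) ≤ (Fintype.card E : ℝ) ^ c := by
  rcases A.eq_empty_or_nonempty with rfl | hA
  · rw [Set.ncard_empty, Nat.cast_zero]
    positivity
  · rw [subsetDensity, if_neg hA.ne_empty, EReal.coe_lt_coe_iff, Nat.card_eq_fintype_card] at h
    exact ((Real.logb_lt_iff_lt_rpow (by exact_mod_cast hE)
      (by exact_mod_cast (Set.ncard_pos A.toFinite).2 hA)).1 h).le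

theorem rpow_le_ncard_of_lt_subsetDensity (hE : 2 ≤ Fintype.card E)
    (h : (c : EReal) < subsetDensity A) : (Fintype.card E : ℝ) ^ c ≤ A.ncard := by
  rcases A.eq_empty_or_nonempty with rfl | hA
  · rw [subsetDensity, if_pos rfl] at h
    exact absurd h not_lt_bot
  · rw [subsetDensity, if_neg hA.ne_empty, EReal.coe_lt_coe_iff, Nat.card_eq_fintype_card] at h
    exact ((Real.lt_logb_iff_rpow_lt (by exact_mod_cast hE)
      (by exact_mod_cast (Set.ncard_pos A.toFinite).2 hA)).1 h).le

end Density

section FewRelators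

open Finset

variable {m p ℓ : ℕ}

/-- `badRelators` as an operation on sets of elements of `relatorBall m ℓ`. -/
noncomputable def badRelatorsInBall (p : ℕ) (T : Finset (relatorBall m ℓ)) :
    Finset (relatorBall m ℓ) :=
  open Classical in
  (badRelators p ℓ (T.map (Function.Embedding.subtype _))).subtype (· ∈ relatorBall m ℓ)

theorem mem_badRelatorsInBall {T : Finset (relatorBall m ℓ)} {r : relatorBall m ℓ} :
    r ∈ badRelatorsInBall p T ↔
      r.val ∈ badRelators p ℓ (T.map (Function.Embedding.subtype _)) := by
  classical exact mem_subtype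

theorem card_badRelatorsInBall_le (hm : 0 < m) {T : Finset (relatorBall m ℓ)} (hT : #T ≤ p) :
    (#(badRelatorsInBall p T) : ℝ) ≤ badRelatorsBound m p #T ℓ := by
  classical
  have hsub : #(badRelatorsInBall p T) ≤
      #(badRelators p ℓ (T.map (Function.Embedding.subtype _))) := by
    rw [badRelatorsInBall, card_subtype]
    exact card_filter_le _ _
  have hbound := card_badRelators_le (p := p) (ℓ := ℓ)
    (T := T.map (Function.Embedding.subtype _)) hm
    (forall_mem_map.2 fun r _ => r.2.2) (by rwa [card_map])
  rw [card_map] at hbound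
  exact (Nat.cast_le.2 hsub).trans hbound

theorem exists_mem_badRelatorsInBall_of_not_satisfiesB {A : Set (relatorBall m ℓ)}
    (hA : ¬ SatisfiesB p (Subtype.val '' A)) : ∃ T : Finset (relatorBall m ℓ),
      (T : Set (relatorBall m ℓ)) ⊆ A ∧ #T ≤ p ∧ ∃ r ∈ badRelatorsInBall p T, r ∈ A ∧ r ∉ T := by
  classical
  obtain ⟨T, hTA, hTp, r, hrT, ⟨r, hrA, rfl⟩, hr⟩ :=
    exists_mem_badRelators_of_not_satisfiesB (Subtype.coe_image_subset _ A) hA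
  have hmap : (T.subtype (· ∈ relatorBall m ℓ)).map (Function.Embedding.subtype _) = T :=
    subtype_map_of_mem fun w hw => Subtype.coe_image_subset _ A (hTA hw)
  refine ⟨T.subtype (· ∈ relatorBall m ℓ), fun x hx => ?_, ?_, r, ?_, hrA, ?_⟩
  · exact Subtype.val_injective.mem_set_image.1 (hTA (mem_subtype.1 hx))
  · rwa [← card_map (Function.Embedding.subtype _), hmap]
  · rwa [mem_badRelatorsInBall, hmap]
  · rwa [mem_subtype]

theorem badRelatorsBound_mul_rpow_le (hm : 2 ≤ m) (hℓ : 2 ≤ ℓ) {c : ℝ} (hc : 0 ≤ c)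
    (hcp : c ≤ 1 / (2 * p + 2)) {k : ℕ} (hk : k ≤ p) :
    badRelatorsBound m p k ℓ * (Fintype.card (relatorBall m ℓ) : ℝ) ^ (c * (k + 1) - 1) ≤
      2 * (2 * (2 * p + 2) ^ p + 8) * (ℓ + 1) ^ (2 * p + 3) *
        ((2 * m - 1 : ℕ) : ℝ) ^ (3 - ℓ * (1 / (2 * p + 2) - c)) := by
  have hb := one_lt_two_mul_sub_one hm
  have hcard := rpow_le_card_relatorBall hm hℓ
  set b : ℝ := ((2 * m - 1 : ℕ) : ℝ)
  have hb0 : 0 < b := by linarith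
  have hexp : c * (k + 1) - 1 ≤ 0 := by
    have hkp : (k : ℝ) + 1 ≤ 2 * p + 2 := by exact_mod_cast (by omega : k + 1 ≤ 2 * p + 2)
    rw [le_div_iff₀ (by positivity)] at hcp
    nlinarith
  have hpow : (Fintype.card (relatorBall m ℓ) : ℝ) ^ (c * (k + 1) - 1) ≤
      b ^ ((ℓ - 2) * (c * (k + 1) - 1)) := by
    rw [Real.rpow_mul hb0.le]
    exact Real.rpow_le_rpow_of_nonpos (by positivity) hcard hexp
  rw [badRelatorsBound, mul_assoc _ (b ^ _)]
  refine mul_le_mul_of_nonneg_left ?_ (by positivity)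
  calc b ^ (1 + ℓ * (1 - (k + 1) / (2 * p + 2)) : ℝ) * _
      ≤ b ^ (1 + ℓ * (1 - (k + 1) / (2 * p + 2)) : ℝ) * b ^ ((ℓ - 2) * (c * (k + 1) - 1)) := by
        gcongr
    _ = b ^ (3 - ℓ * (1 / (2 * p + 2) - c) -
          (ℓ * k * (1 / (2 * p + 2) - c) + 2 * c * (k + 1))) := by
        rw [← Real.rpow_add hb0]
        ring_nf
    _ ≤ b ^ (3 - ℓ * (1 / (2 * p + 2) - c)) := by
        refine Real.rpow_le_rpow_of_exponent_le hb.le (sub_le_self _ ?_)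
        have := sub_nonneg.2 hcp
        positivity

theorem measureReal_not_satisfiesB_le (hm : 2 ≤ m) (hℓ : 2 ≤ ℓ) {Ω' : Type*}
    [MeasurableSpace Ω'] {P : Measure Ω'} [IsProbabilityMeasure P]
    {R : Ω' → Set (relatorBall m ℓ)} (hR : IsRandomSubset R) (hP : IsPermutationInvariant P R)
    {c : ℝ} (hc : 0 ≤ c) (hcp : c ≤ 1 / (2 * p + 2)) :
    P.real {ω | ¬ SatisfiesB p (Subtype.val '' R ω) ∧
        (R ω).ncard ≤ (Fintype.card (relatorBall m ℓ) : ℝ) ^ c} ≤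
      (p + 1) * (2 * (2 * (2 * p + 2) ^ p + 8) * (ℓ + 1) ^ (2 * p + 3) *
        ((2 * m - 1 : ℕ) : ℝ) ^ (3 - ℓ * (1 / (2 * p + 2) - c))) := by
  have hN : 0 < (Fintype.card (relatorBall m ℓ) : ℝ) :=
    (Real.rpow_pos_of_pos (by linarith [one_lt_two_mul_sub_one hm]) _).trans_le
      (rpow_le_card_relatorBall hm hℓ)
  set N : ℝ := (Fintype.card (relatorBall m ℓ) : ℝ)
  let bad (k : ℕ) : Set Ω' := {ω | (∃ T : Finset (relatorBall m ℓ), #T = k ∧ ↑T ⊆ R ω ∧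
    ∃ r ∈ badRelatorsInBall p T, r ∈ R ω ∧ r ∉ T) ∧ (R ω).ncard ≤ N ^ c}
  have hsub : {ω | ¬ SatisfiesB p (Subtype.val '' R ω) ∧ (R ω).ncard ≤ N ^ c} ⊆
      ⋃ k ∈ range (p + 1), bad k := by
    rintro ω ⟨hω, hcard⟩
    obtain ⟨T, hTR, hTp, hr⟩ := exists_mem_badRelatorsInBall_of_not_satisfiesB hω
    exact Set.mem_biUnion (Finset.mem_range.2 (Nat.lt_succ_of_le hTp)) ⟨⟨T, rfl, hTR, hr⟩, hcard⟩
  have hbad : ∀ k ∈ range (p + 1), P.real (bad k) ≤ 2 * (2 * (2 * p + 2) ^ p + 8) *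
      (ℓ + 1) ^ (2 * p + 3) * ((2 * m - 1 : ℕ) : ℝ) ^ (3 - ℓ * (1 / (2 * p + 2) - c)) := by
    intro k hk
    have hkp := Nat.lt_succ_iff.1 (Finset.mem_range.1 hk)
    have hmoment : P.real (bad k) * N ≤ badRelatorsBound m p k ℓ * (N ^ c) ^ (k + 1) :=
      hP.measureReal_exists_mul_le hR k (badRelatorsInBall p)
        (by rw [badRelatorsBound]; positivity) (by positivity)
        fun T hT => hT ▸ card_badRelatorsInBall_le (by omega) (hT.trans_le hkp)
    calc P.real (bad k) ≤ badRelatorsBound m p k ℓ * (N ^ c) ^ (k + 1) / N :=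
          (le_div_iff₀ hN).2 hmoment
      _ = badRelatorsBound m p k ℓ * N ^ (c * (k + 1) - 1) := by
          rw [← Real.rpow_mul_natCast hN.le, mul_div_assoc, Real.rpow_sub_one hN.ne']
          push_cast
          rfl
      _ ≤ _ := badRelatorsBound_mul_rpow_le hm hℓ hc hcp hkp
  calc _ ≤ P.real (⋃ k ∈ range (p + 1), bad k) := measureReal_mono hsub (measure_ne_top _ _)
    _ ≤ ∑ k ∈ range (p + 1), P.real (bad k) := measureReal_biUnion_finset_le _ _
    _ ≤ #(range (p + 1)) • _ := sum_le_card_nsmul _ _ _ hbad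
    _ = _ := by rw [card_range, nsmul_eq_mul, Nat.cast_succ]

theorem tendsto_pow_mul_rpow_sub_nhds_zero {b s : ℝ} (hb : 1 < b) (hs : 0 < s) (C a : ℝ) (j : ℕ) :
    Tendsto (fun ℓ : ℕ => C * ((ℓ + 1) ^ j * b ^ (a - ℓ * s))) atTop (𝓝 0) := by
  have hb0 : 0 < b := by linarith
  have hlim := ((tendsto_pow_const_mul_const_pow_of_abs_lt_one j (r := b ^ (-s)) (by
    rw [abs_of_pos (Real.rpow_pos_of_pos hb0 _)]
    exact Real.rpow_lt_one_of_one_lt_of_neg hb (neg_lt_zero.2 hs))).comp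
      (tendsto_add_atTop_nat 1)).const_mul (C * b ^ (a + s))
  rw [mul_zero] at hlim
  refine hlim.congr fun ℓ => ?_
  have hexp : b ^ (a - ℓ * s) = b ^ (a + s) * (b ^ (-s)) ^ (ℓ + 1) := by
    rw [← Real.rpow_mul_natCast hb0.le, ← Real.rpow_add hb0]
    push_cast
    ring_nf
  rw [hexp, Function.comp_apply]
  push_cast
  ring

end FewRelators

section Violation

variable {m p : ℕ} {R : Set (GWord m)}

theorem SatisfiesB.satisfiesWeakB (h : SatisfiesB p R) : SatisfiesWeakB p R :=
  fun r hr s hs hp => (h r hr s hs hp).le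

theorem not_satisfiesWeakB_of_flatten_isPrefix {w : GWord m} (hw : w ∈ R) {L : List (GWord m)}
    (hLp : L.length ≤ p) (hLw : L.flatten <+: w) (hlong : w.length < 2 * L.flatten.length)
    (hL : ∀ u ∈ L, ∃ r ∈ R, r.length ≠ w.length ∧ u <+: r) : ¬ SatisfiesWeakB p R := by
  refine fun h => (h w ⟨w, hw, Or.inl (List.IsRotated.refl w)⟩ _ hLw
    ⟨L, hLp, fun u hu => ?_, rfl⟩).not_gt hlong
  obtain ⟨r, hr, hne, hur⟩ := hL u hu
  obtain ⟨v, hvw, huv⟩ := exists_isRotated_isPrefix_of_isInfix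
    ((List.infix_of_mem_flatten hu).trans hLw.isInfix)
  refine ⟨v, ⟨w, hw, Or.inl hvw⟩, r, ⟨r, hr, Or.inl (List.IsRotated.refl r)⟩, ?_, huv, hur⟩
  rintro rfl
  exact hne hvw.perm.length_eq

end Violation

section ManyRelators

open Finset

variable {m ℓ : ℕ}

/-- The words of `S` that belong to `relatorBall m ℓ`, as elements of that type. -/
noncomputable def relatorsIn (ℓ : ℕ) (S : Finset (GWord m)) : Finset (relatorBall m ℓ) :=
  open Classical in S.subtype (· ∈ relatorBall m ℓ)

theorem mem_relatorsIn {S : Finset (GWord m)} {e : relatorBall m ℓ} :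
    e ∈ relatorsIn ℓ S ↔ e.val ∈ S := by
  classical exact mem_subtype

theorem card_relatorsIn {S : Finset (GWord m)} (hS : (S : Set (GWord m)) ⊆ relatorBall m ℓ) :
    #(relatorsIn ℓ S) = #S := by
  classical
  rw [relatorsIn, card_subtype, filter_true_of_mem fun w hw => hS (mem_coe.2 hw)]

/-- The relators of length `ℓ - 1` with initial segment `u`. They are shorter than the relators in
a target set, so that a common initial segment is a piece. -/
noncomputable def relatorsWithPrefix (ℓ : ℕ) (u : GWord m) : Finset (relatorBall m ℓ) :=
  {e | e.val.length + 1 = ℓ ∧ u <+: e.val}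

theorem HitsTarget.not_satisfiesWeakB {x : Fin m × Bool} {p L K : ℕ} (hpL : p * L ≤ ℓ)
    (hℓ : ℓ < 2 * (p * L)) {A : Set (relatorBall m ℓ)}
    (hA : HitsTarget (anchoredWords x L) K (relatorsWithPrefix ℓ)
      (fun D => relatorsIn ℓ (concatenations D (anchoredWords x (ℓ - p * L)) p)) A) :
    ¬ SatisfiesWeakB p (Subtype.val '' A) := by
  obtain ⟨D, hDU, -, hD, e, heA, heD⟩ := hA
  have he := mem_relatorsIn.1 (mem_coe.1 heD)
  have helen : e.val.length = ℓ := by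
    have := (mem_anchoredWords.1 (concatenations_subset_anchoredWords hDU subset_rfl p he)).1
    omega
  obtain ⟨Ls, hLs, hLD, hLe⟩ := exists_flatten_isPrefix_of_mem_concatenations he
  have hflat : Ls.flatten.length = p * L := by
    have hmap : Ls.map List.length = List.replicate p L := List.eq_replicate_iff.2
      ⟨by rw [List.length_map, hLs], List.forall_mem_map.2 fun u hu =>
        (mem_anchoredWords.1 (hDU (hLD u hu))).1⟩
    rw [List.length_flatten, hmap, List.sum_replicate, smul_eq_mul]
  refine not_satisfiesWeakB_of_flatten_isPrefix (Set.mem_image_of_mem _ heA) hLs.le hLe (by omega)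
    fun u hu => ?_
  obtain ⟨e', he'A, he'u⟩ := hD u (hLD u hu)
  obtain ⟨hlen, hpre⟩ := (mem_filter.1 (mem_coe.1 he'u)).2
  exact ⟨e', Set.mem_image_of_mem _ he'A, by omega, hpre⟩

theorem card_mul_card_anchoredWords_le {x : Fin m × Bool} {L : ℕ} (hL : L < ℓ)
    {V : Finset (GWord m)} (hV : V ⊆ anchoredWords x L) :
    #V * #(anchoredWords x (ℓ - 1 - L)) ≤ #(V.biUnion (relatorsWithPrefix ℓ)) := by
  have hconcat := concatenations_subset_anchoredWords hV subset_rfl (k := ℓ - 1 - L) 1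
  have hball := (coe_subset.2 hconcat).trans
    (anchoredWords_subset_relatorBall (by omega : 1 * L + (ℓ - 1 - L) ≤ ℓ))
  rw [← pow_one #V, ← card_concatenations fun u hu => (mem_anchoredWords.1 (hV hu)).1,
    ← card_relatorsIn hball]
  refine card_le_card fun e he => ?_
  have he' := mem_relatorsIn.1 he
  obtain ⟨u, hu, v, -, huv⟩ := mem_image₂.1 he'
  have hlen := (mem_anchoredWords.1 (hconcat he')).1
  exact mem_biUnion.2 ⟨u, hu, mem_filter.2 ⟨mem_univ _, by omega, v, huv⟩⟩

theorem mul_card_relatorBall_le_card_biUnion (hm : 2 ≤ m) {x : Fin m × Bool} {L : ℕ} (hL : 2 ≤ L)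
    (hLℓ : L + 3 ≤ ℓ) {D : Finset (GWord m)} (hD : D ⊆ anchoredWords x L)
    (hK : 2 * #D ≤ ((2 * m - 1 : ℕ) : ℝ) ^ ((L : ℝ) - 2)) :
    1 / (8 * ((2 * m - 1 : ℕ) : ℝ) ^ 5) * Fintype.card (relatorBall m ℓ) ≤
      #((anchoredWords x L \ D).biUnion (relatorsWithPrefix ℓ)) := by
  have hb := one_lt_two_mul_sub_one hm
  have hcard := card_relatorBall_le hm ℓ
  have hU := rpow_le_card_anchoredWords hm x hL
  have hT := rpow_le_card_anchoredWords hm x (k := ℓ - 1 - L) (by omega)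
  have hcells := card_mul_card_anchoredWords_le (by omega : L < ℓ)
    (sdiff_subset : anchoredWords x L \ D ⊆ _)
  rw [card_sdiff_of_subset hD] at hcells
  set b : ℝ := ((2 * m - 1 : ℕ) : ℝ)
  have hb0 : 0 < b := by linarith
  have hsdiff : b ^ ((L : ℝ) - 2) / 2 ≤ (#(anchoredWords x L) - #D : ℕ) := by
    rw [Nat.cast_sub (card_le_card hD)]
    linarith
  have hexp : b ^ ℓ = b ^ ((L : ℝ) - 2) * b ^ (((ℓ - 1 - L : ℕ) : ℝ) - 2) * b ^ 5 := by
    rw [← Real.rpow_natCast b ℓ, ← Real.rpow_natCast b 5, ← Real.rpow_add hb0,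
      ← Real.rpow_add hb0, Nat.cast_sub (by omega), Nat.cast_sub (by omega)]
    push_cast
    ring_nf
  calc 1 / (8 * b ^ 5) * Fintype.card (relatorBall m ℓ) ≤ 1 / (8 * b ^ 5) * (4 * b ^ ℓ) := by
        gcongr
    _ = b ^ ((L : ℝ) - 2) / 2 * b ^ (((ℓ - 1 - L : ℕ) : ℝ) - 2) := by
        rw [hexp]
        field_simp
        norm_num
    _ ≤ (#(anchoredWords x L) - #D : ℕ) * #(anchoredWords x (ℓ - 1 - L)) := by gcongr
    _ ≤ _ := by exact_mod_cast hcells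

theorem mul_card_relatorBall_le_card_concatenations (hm : 2 ≤ m) {x : Fin m × Bool} {p L : ℕ}
    (hpL : p * L + 2 ≤ ℓ) {D : Finset (GWord m)} (hD : D ⊆ anchoredWords x L) :
    #D ^ p * ((2 * m - 1 : ℕ) : ℝ) ^ (-(p * L : ℝ) - 2) / 4 * Fintype.card (relatorBall m ℓ) ≤
      #(relatorsIn ℓ (concatenations D (anchoredWords x (ℓ - p * L)) p)) := by
  have hb := one_lt_two_mul_sub_one hm
  have hcard := card_relatorBall_le hm ℓ
  have hT := rpow_le_card_anchoredWords hm x (k := ℓ - p * L) (by omega)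
  have hball := (coe_subset.2 (concatenations_subset_anchoredWords hD
    (subset_rfl : anchoredWords x (ℓ - p * L) ⊆ _) p)).trans
      (anchoredWords_subset_relatorBall (by omega : p * L + (ℓ - p * L) ≤ ℓ))
  rw [card_relatorsIn hball, card_concatenations fun u hu => (mem_anchoredWords.1 (hD hu)).1]
  set b : ℝ := ((2 * m - 1 : ℕ) : ℝ)
  have hb0 : 0 < b := by linarith
  calc _ ≤ #D ^ p * b ^ (-(p * L : ℝ) - 2) / 4 * (4 * b ^ ℓ) := by gcongr
    _ = #D ^ p * (b ^ (-(p * L : ℝ) - 2) * b ^ (ℓ : ℝ)) := by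
        rw [Real.rpow_natCast]
        ring
    _ = #D ^ p * b ^ (((ℓ - p * L : ℕ) : ℝ) - 2) := by
        rw [← Real.rpow_add hb0, Nat.cast_sub (by omega)]
        push_cast
        ring_nf
    _ ≤ #D ^ p * #(anchoredWords x (ℓ - p * L)) := by gcongr
    _ = _ := by push_cast; rfl

theorem card_anchoredWords_le_pow (hm : 2 ≤ m) (x : Fin m × Bool) {L : ℕ} (hL : L < ℓ) :
    #(anchoredWords x L) ≤ (2 * m - 1) ^ ℓ := by
  have hred : #(anchoredWords x L) ≤ 2 * (2 * m - 1) ^ L := by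
    classical
    simpa only [anchoredWords, Fintype.card_fin] using
      (card_filter_le (reducedWords (Fin m) L) _).trans (card_reducedWords_le (α := Fin m) L)
  calc _ ≤ _ := hred
    _ ≤ (2 * m - 1) * (2 * m - 1) ^ L := Nat.mul_le_mul_right _ (by omega)
    _ = (2 * m - 1) ^ (L + 1) := (pow_succ' _ _).symm
    _ ≤ (2 * m - 1) ^ ℓ := Nat.pow_le_pow_right (by omega) hL

theorem measureReal_satisfiesWeakB_le (hm : 2 ≤ m) {p L K : ℕ} (M : ℕ) {Ω' : Type*}
    [MeasurableSpace Ω'] {P : Measure Ω'} [IsProbabilityMeasure P]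
    {R : Ω' → Set (relatorBall m ℓ)} (hR : IsRandomSubset R) (hP : IsPermutationInvariant P R)
    (hL : 2 ≤ L) (hLℓ : L + 3 ≤ ℓ) (hpL : p * L + 2 ≤ ℓ) (hℓ : ℓ < 2 * (p * L))
    (hK : 2 * K ≤ ((2 * m - 1 : ℕ) : ℝ) ^ ((L : ℝ) - 2)) :
    P.real {ω | SatisfiesWeakB p (Subtype.val '' R ω) ∧ 2 * M ≤ (R ω).ncard} ≤
      (((2 * m - 1 : ℕ) : ℝ) ^ ℓ) ^ K * Real.exp (-(1 / (8 * ((2 * m - 1 : ℕ) : ℝ) ^ 5)) * M) +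
        Real.exp (-(K ^ p * ((2 * m - 1 : ℕ) : ℝ) ^ (-(p * L : ℝ) - 2) / 4) * M) := by
  have : Nonempty (relatorBall m ℓ) := ⟨⟨[], by simp [relatorBall]⟩⟩
  let x : Fin m × Bool := (⟨0, by omega⟩, true)
  have hKU : K ≤ #(anchoredWords x L) := by
    have hU := rpow_le_card_anchoredWords hm x hL
    exact_mod_cast (by linarith [K.cast_nonneg (α := ℝ)] : (K : ℝ) ≤ #(anchoredWords x L))
  have hU : (#(anchoredWords x L) : ℝ) ≤ ((2 * m - 1 : ℕ) : ℝ) ^ ℓ := by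
    exact_mod_cast card_anchoredWords_le_pow hm x (by omega : L < ℓ)
  refine (measureReal_mono (fun ω hω => ?_) (measure_ne_top _ _)).trans
    ((hP.measureReal_not_hitsTarget_le hR hKU
      (fun D hD hDK => mul_card_relatorBall_le_card_biUnion hm hL hLℓ hD (hDK ▸ hK))
      (fun D hD hDK => hDK ▸ mul_card_relatorBall_le_card_concatenations hm hpL hD) M).trans ?_)
  · exact ⟨fun h => h.not_satisfiesWeakB (by omega) hℓ hω.1, hω.2⟩
  · gcongr

end ManyRelators

section Growth

variable {b s t : ℝ}

theorem tendsto_rpow_mul_natCast_atTop (hb : 1 < b) (hs : 0 < s) :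
    Tendsto (fun ℓ : ℕ => b ^ (s * ℓ)) atTop atTop :=
  (tendsto_rpow_atTop_of_base_gt_one b hb).comp
    (tendsto_natCast_atTop_atTop.const_mul_atTop hs)

theorem ceil_rpow_mul_natCast_le (hb : 1 < b) (hs : 0 ≤ s) (ℓ : ℕ) :
    (⌈b ^ (s * ℓ)⌉₊ : ℝ) ≤ 2 * b ^ (s * ℓ) :=
  Nat.ceil_le_two_mul (by linarith [Real.one_le_rpow hb.le (by positivity : 0 ≤ s * ℓ)])

theorem eventually_two_mul_ceil_rpow_le (hb : 1 < b) (hs : 0 ≤ s) (hst : s < t) (a : ℝ) :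
    ∀ᶠ ℓ : ℕ in atTop, 2 * (⌈b ^ (s * ℓ)⌉₊ : ℝ) ≤ b ^ (t * ℓ - a) := by
  have hb0 : 0 < b := by linarith
  filter_upwards [(tendsto_rpow_mul_natCast_atTop hb (sub_pos.2 hst)).eventually_ge_atTop
    (4 * b ^ a)] with ℓ hℓ
  calc 2 * (⌈b ^ (s * ℓ)⌉₊ : ℝ) ≤ 2 * (2 * b ^ (s * ℓ)) := by
        gcongr
        exact ceil_rpow_mul_natCast_le hb hs ℓ
    _ = 4 * b ^ a * b ^ (s * ℓ - a) := by
        rw [mul_assoc 4, ← Real.rpow_add hb0]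
        ring_nf
    _ ≤ b ^ ((t - s) * ℓ) * b ^ (s * ℓ - a) := by gcongr
    _ = b ^ (t * ℓ - a) := by
        rw [← Real.rpow_add hb0]
        ring_nf

theorem tendsto_mul_rpow_sub_linear_mul_rpow_atTop (hb : 1 < b) (hst : s < t) (ht : 0 < t) {x : ℝ}
    (hx : 0 < x) (C : ℝ) :
    Tendsto (fun ℓ : ℕ => x * b ^ (t * ℓ) - C * ℓ * b ^ (s * ℓ)) atTop atTop := by
  have hb0 : 0 < b := by linarith
  have hlim : Tendsto (fun ℓ : ℕ => x - C * ((ℓ : ℝ) ^ 1 * (b ^ (s - t)) ^ ℓ)) atTop (𝓝 x) := by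
    have hr : |b ^ (s - t)| < 1 := by
      rw [abs_of_pos (Real.rpow_pos_of_pos hb0 _)]
      exact Real.rpow_lt_one_of_one_lt_of_neg hb (by linarith)
    simpa using ((tendsto_pow_const_mul_const_pow_of_abs_lt_one 1 hr).const_mul C).const_sub x
  refine ((tendsto_rpow_mul_natCast_atTop hb ht).atTop_mul_pos hx hlim).congr fun ℓ => ?_
  have hpow : b ^ (s * ℓ) = b ^ (t * ℓ) * (b ^ (s - t)) ^ ℓ := by
    rw [← Real.rpow_mul_natCast hb0.le, ← Real.rpow_add hb0]
    ring_nf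
  rw [hpow]
  ring

theorem tendsto_pow_ceil_mul_exp_neg_nhds_zero (hb : 1 < b) (hs : 0 ≤ s) (hst : s < t) {x : ℝ}
    (hx : 0 < x) :
    Tendsto (fun ℓ : ℕ => (b ^ ℓ) ^ ⌈b ^ (s * ℓ)⌉₊ * Real.exp (-x * ⌈b ^ (t * ℓ)⌉₊))
      atTop (𝓝 0) := by
  have hlim := Real.tendsto_exp_neg_atTop_nhds_zero.comp
    (tendsto_mul_rpow_sub_linear_mul_rpow_atTop hb hst (by linarith) hx (2 * Real.log b))
  refine squeeze_zero (fun ℓ => by positivity) (fun ℓ => ?_) hlim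
  have hlog : 0 ≤ Real.log b := Real.log_nonneg hb.le
  have hK : ⌈b ^ (s * ℓ)⌉₊ * (ℓ * Real.log b) ≤ 2 * b ^ (s * ℓ) * (ℓ * Real.log b) := by
    gcongr
    exact ceil_rpow_mul_natCast_le hb hs ℓ
  have hM : x * b ^ (t * ℓ) ≤ x * ⌈b ^ (t * ℓ)⌉₊ := by
    gcongr
    exact Nat.le_ceil _
  calc (b ^ ℓ) ^ ⌈b ^ (s * ℓ)⌉₊ * Real.exp (-x * ⌈b ^ (t * ℓ)⌉₊)
      = Real.exp (⌈b ^ (s * ℓ)⌉₊ * (ℓ * Real.log b) - x * ⌈b ^ (t * ℓ)⌉₊) := by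
        rw [sub_eq_add_neg, Real.exp_add, Real.exp_nat_mul, Real.exp_nat_mul,
          Real.exp_log (by linarith), neg_mul]
    _ ≤ _ := Real.exp_le_exp.2 (by linarith)

theorem tendsto_exp_neg_ceil_mul_ceil_nhds_zero (hb : 1 < b) {p : ℕ} (hst : 1 / 2 < t + p * s)
    {a : ℝ} {k : ℕ → ℝ} (hk : ∀ ℓ, k ℓ ≤ ℓ / 2 + a) :
    Tendsto (fun ℓ : ℕ => Real.exp (-(⌈b ^ (s * ℓ)⌉₊ ^ p * b ^ (-k ℓ) / 4) * ⌈b ^ (t * ℓ)⌉₊))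
      atTop (𝓝 0) := by
  have hb0 : 0 < b := by linarith
  have hlim : Tendsto (fun ℓ : ℕ => b ^ (-a) / 4 * b ^ ((t + p * s - 1 / 2) * ℓ)) atTop atTop :=
    (tendsto_rpow_mul_natCast_atTop hb (by linarith)).const_mul_atTop (by positivity)
  refine squeeze_zero (fun ℓ => by positivity) (fun ℓ => ?_)
    (Real.tendsto_exp_neg_atTop_nhds_zero.comp hlim)
  rw [Function.comp_apply, neg_mul]
  refine Real.exp_le_exp.2 (neg_le_neg ?_)
  calc b ^ (-a) / 4 * b ^ ((t + p * s - 1 / 2) * ℓ)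
      = (b ^ (s * ℓ)) ^ p * b ^ (-(ℓ / 2 + a)) / 4 * b ^ (t * ℓ) := by
        rw [div_mul_eq_mul_div, div_mul_eq_mul_div, ← Real.rpow_mul_natCast hb0.le,
          ← Real.rpow_add hb0, ← Real.rpow_add hb0, ← Real.rpow_add hb0]
        ring_nf
    _ ≤ _ := by
        gcongr
        · exact Nat.le_ceil _
        · exact hb.le
        · exact hk ℓ
        · exact Nat.le_ceil _

end Growth

section AsymptoticallyAlmostSurely

variable {Ω : ℕ → Type*} [∀ ℓ, MeasurableSpace (Ω ℓ)] {P : ∀ ℓ, Measure (Ω ℓ)}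
  [∀ ℓ, IsProbabilityMeasure (P ℓ)]

theorem AAS.mono {Q Q' : ∀ ℓ, Ω ℓ → Prop} (hQ : AAS P Q) (h : ∀ ℓ ω, Q ℓ ω → Q' ℓ ω) :
    AAS P Q' :=
  tendsto_of_tendsto_of_tendsto_of_le_of_le hQ tendsto_const_nhds
    (fun ℓ => measure_mono (h ℓ)) (fun _ => prob_le_one)

theorem aas_of_tendsto_measure_not {Q : ∀ ℓ, Ω ℓ → Prop}
    (hQ : Tendsto (fun ℓ => P ℓ {ω | ¬ Q ℓ ω}) atTop (𝓝 0)) : AAS P Q := by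
  have hlim : Tendsto (fun ℓ => 1 - P ℓ {ω | ¬ Q ℓ ω}) atTop (𝓝 1) := by
    simpa using ENNReal.Tendsto.sub tendsto_const_nhds hQ (Or.inl ENNReal.one_ne_top)
  refine tendsto_of_tendsto_of_tendsto_of_le_of_le hlim tendsto_const_nhds
    (fun ℓ => tsub_le_iff_right.2 ?_) (fun _ => prob_le_one)
  exact measure_univ (μ := P ℓ) ▸ measure_univ_le_add_compl {ω | Q ℓ ω}

theorem aas_of_tendsto_measureReal_and {Q D : ∀ ℓ, Ω ℓ → Prop}
    (hD : Tendsto (fun ℓ => P ℓ {ω | ¬ D ℓ ω}) atTop (𝓝 0))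
    (hQ : Tendsto (fun ℓ => (P ℓ).real {ω | ¬ Q ℓ ω ∧ D ℓ ω}) atTop (𝓝 0)) : AAS P Q := by
  have hlim : Tendsto (fun ℓ => P ℓ {ω | ¬ Q ℓ ω ∧ D ℓ ω} + P ℓ {ω | ¬ D ℓ ω}) atTop (𝓝 0) := by
    simpa [ofReal_measureReal] using (ENNReal.tendsto_ofReal hQ).add hD
  refine aas_of_tendsto_measure_not (tendsto_of_tendsto_of_tendsto_of_le_of_le
    tendsto_const_nhds hlim (fun _ => zero_le) fun ℓ => ?_)
  refine (measure_mono fun ω hω => ?_).trans (measure_union_le _ _)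
  by_cases hDω : D ℓ ω
  exacts [Or.inl ⟨hω, hDω⟩, Or.inr hDω]

variable {m p : ℕ} {R : ∀ ℓ, Ω ℓ → Set (relatorBall m ℓ)}

theorem tendsto_measureReal_not_satisfiesB (hm : 2 ≤ m) (hR : ∀ ℓ, IsRandomSubset (R ℓ))
    (hP : ∀ ℓ, IsPermutationInvariant (P ℓ) (R ℓ)) {c : ℝ} (hc : 0 ≤ c)
    (hcp : c < 1 / (2 * p + 2)) :
    Tendsto (fun ℓ => (P ℓ).real {ω | ¬ SatisfiesB p (Subtype.val '' R ℓ ω) ∧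
      (R ℓ ω).ncard ≤ (Fintype.card (relatorBall m ℓ) : ℝ) ^ c}) atTop (𝓝 0) := by
  refine squeeze_zero' (Eventually.of_forall fun _ => measureReal_nonneg) ?_
    (tendsto_pow_mul_rpow_sub_nhds_zero (one_lt_two_mul_sub_one hm) (sub_pos.2 hcp)
      ((p + 1) * (2 * (2 * (2 * p + 2) ^ p + 8))) 3 (2 * p + 3))
  filter_upwards [eventually_ge_atTop 2] with ℓ hℓ
  refine (measureReal_not_satisfiesB_le hm hℓ (hR ℓ) (hP ℓ) hc hcp.le).trans_eq ?_
  ring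

/-- The length of the initial segments of which `p` make up just over half of a relator of
length `ℓ`. -/
def blockLength (p ℓ : ℕ) : ℕ := ℓ / (2 * p) + 1

theorem lt_two_mul_mul_blockLength (hp : 1 ≤ p) (ℓ : ℕ) : ℓ < 2 * (p * blockLength p ℓ) := by
  rw [← mul_assoc, blockLength]
  exact Nat.lt_mul_div_succ ℓ (by omega)

theorem two_mul_mul_blockLength_le (p ℓ : ℕ) : 2 * (p * blockLength p ℓ) ≤ ℓ + 2 * p := by
  rw [← mul_assoc, blockLength, mul_add, mul_one]
  exact Nat.add_le_add_right (Nat.mul_div_le ℓ (2 * p)) _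

theorem eventually_two_mul_ceil_le_rpow_blockLength (hm : 2 ≤ m) (hp : 1 ≤ p) {β : ℝ}
    (hβ : 0 ≤ β) (hβp : β < 1 / (2 * p)) :
    ∀ᶠ ℓ : ℕ in atTop, 2 * (⌈((2 * m - 1 : ℕ) : ℝ) ^ (β * ℓ)⌉₊ : ℝ) ≤
      ((2 * m - 1 : ℕ) : ℝ) ^ ((blockLength p ℓ : ℝ) - 2) := by
  have hb := one_lt_two_mul_sub_one hm
  filter_upwards [eventually_two_mul_ceil_rpow_le hb hβ hβp 2] with ℓ hℓ
  refine hℓ.trans (Real.rpow_le_rpow_of_exponent_le hb.le (sub_le_sub_right ?_ 2))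
  have hL : (ℓ : ℝ) ≤ 2 * (p * blockLength p ℓ) := by
    exact_mod_cast (lt_two_mul_mul_blockLength hp ℓ).le
  rw [one_div_mul_eq_div, div_le_iff₀ (by positivity)]
  linarith

theorem eventually_two_mul_ceil_le_rpow_card_relatorBall (hm : 2 ≤ m) {α γ : ℝ} (hα : 0 ≤ α)
    (hαγ : α < γ) :
    ∀ᶠ ℓ : ℕ in atTop, 2 * (⌈((2 * m - 1 : ℕ) : ℝ) ^ (α * ℓ)⌉₊ : ℝ) ≤
      (Fintype.card (relatorBall m ℓ) : ℝ) ^ γ := by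
  have hb := one_lt_two_mul_sub_one hm
  filter_upwards [eventually_two_mul_ceil_rpow_le hb hα hαγ (2 * γ), eventually_ge_atTop 2]
    with ℓ hℓ hℓ2
  refine hℓ.trans ?_
  rw [mul_comm γ, ← sub_mul, Real.rpow_mul (by positivity)]
  exact Real.rpow_le_rpow (by positivity) (rpow_le_card_relatorBall hm hℓ2) (by linarith)

theorem tendsto_measureReal_satisfiesWeakB (hm : 2 ≤ m) (hp : 1 ≤ p)
    (hR : ∀ ℓ, IsRandomSubset (R ℓ)) (hP : ∀ ℓ, IsPermutationInvariant (P ℓ) (R ℓ)) {β α γ : ℝ}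
    (hβ : 0 ≤ β) (hβα : β < α) (hαγ : α < γ) (hβp : β < 1 / (2 * p)) (hαβ : 1 / 2 < α + p * β) :
    Tendsto (fun ℓ => (P ℓ).real {ω | SatisfiesWeakB p (Subtype.val '' R ℓ ω) ∧
      (Fintype.card (relatorBall m ℓ) : ℝ) ^ γ ≤ (R ℓ ω).ncard}) atTop (𝓝 0) := by
  have hb := one_lt_two_mul_sub_one hm
  have hlim := (tendsto_pow_ceil_mul_exp_neg_nhds_zero hb hβ hβα
    (x := 1 / (8 * ((2 * m - 1 : ℕ) : ℝ) ^ 5)) (by positivity)).add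
    (tendsto_exp_neg_ceil_mul_ceil_nhds_zero hb hαβ (a := p + 2)
      (k := fun ℓ => p * blockLength p ℓ + 2) fun ℓ => by
        have : (2 * (p * blockLength p ℓ) : ℝ) ≤ ℓ + 2 * p := by
          exact_mod_cast two_mul_mul_blockLength_le p ℓ
        linarith)
  rw [add_zero] at hlim
  refine squeeze_zero' (Eventually.of_forall fun _ => measureReal_nonneg) ?_ hlim
  filter_upwards [eventually_ge_atTop (2 * p + 6),
    eventually_two_mul_ceil_le_rpow_blockLength hm hp hβ hβp,
    eventually_two_mul_ceil_le_rpow_card_relatorBall hm (hβ.trans hβα.le) hαγ] with ℓ hℓ hK hM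
  have hlower := lt_two_mul_mul_blockLength hp ℓ
  have hupper := two_mul_mul_blockLength_le p ℓ
  have hL : 2 ≤ blockLength p ℓ :=
    Nat.succ_le_succ (Nat.div_pos (by omega : 2 * p ≤ ℓ) (by omega))
  have hLp : blockLength p ℓ ≤ p * blockLength p ℓ := Nat.le_mul_of_pos_left _ hp
  refine (measureReal_mono (fun ω hω => ?_) (measure_ne_top _ _)).trans
    ((measureReal_satisfiesWeakB_le hm ⌈((2 * m - 1 : ℕ) : ℝ) ^ (α * ℓ)⌉₊ (hR ℓ) (hP ℓ) hL
      (by omega) (by omega) hlower hK).trans_eq ?_)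
  · exact ⟨hω.1, by exact_mod_cast hM.trans hω.2⟩
  · rw [neg_add']

theorem IsRandomGroupSequence.aas_satisfiesB (hm : 2 ≤ m) {d : EReal}
    (hR : IsRandomGroupSequence m d P R) (hd : d < ((1 / (2 * (p : ℝ) + 2) : ℝ) : EReal)) :
    AAS P (fun ℓ ω => SatisfiesB p (Subtype.val '' R ℓ ω)) := by
  obtain ⟨x, hdx, hx⟩ := EReal.lt_iff_exists_real_btwn.1 hd
  have hdc : d < (max x 0 : ℝ) := hdx.trans_le (EReal.coe_le_coe_iff.2 (le_max_left x 0))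
  have hlim := tendsto_measureReal_not_satisfiesB hm hR.isRandomSubset hR.permutationInvariant
    (le_max_right x 0) (max_lt (EReal.coe_lt_coe_iff.1 hx) (by positivity))
  refine aas_of_tendsto_measureReal_and (hR.densable.2 _ (Iio_mem_nhds hdc))
    (squeeze_zero' (Eventually.of_forall fun _ => measureReal_nonneg) ?_ hlim)
  filter_upwards [(tendsto_card_relatorBall hm).eventually_ge_atTop 2] with ℓ hℓ
  exact measureReal_mono (fun ω hω => ⟨hω.1,
    ncard_le_rpow_of_subsetDensity_lt (by exact_mod_cast hℓ) hω.2⟩) (measure_ne_top _ _)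

theorem IsRandomGroupSequence.aas_not_satisfiesWeakB (hm : 2 ≤ m) (hp : 1 ≤ p) {d : EReal}
    (hR : IsRandomGroupSequence m d P R) (hd : ((1 / (2 * (p : ℝ) + 2) : ℝ) : EReal) < d) :
    AAS P (fun ℓ ω => ¬ SatisfiesWeakB p (Subtype.val '' R ℓ ω)) := by
  obtain ⟨γ, hθγ, hγd⟩ := EReal.lt_iff_exists_real_btwn.1 hd
  set θ : ℝ := 1 / (2 * (p : ℝ) + 2) with hθ
  have hθ0 : 0 < θ := by positivity
  have hθp : θ < 1 / (2 * p) := one_div_lt_one_div_of_lt (by positivity) (by linarith)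
  obtain ⟨α, hθα, hαγ⟩ := exists_between (EReal.coe_lt_coe_iff.1 hθγ)
  obtain ⟨β, hθβ, hβ⟩ := exists_between (lt_min hθα hθp)
  have hαβ : 1 / 2 < α + p * β := by
    calc (1 / 2 : ℝ) = θ + p * θ := by rw [hθ]; field_simp; ring
      _ < α + p * β := by gcongr
  have hlim := tendsto_measureReal_satisfiesWeakB hm hp hR.isRandomSubset hR.permutationInvariant
    (hθ0.trans hθβ).le (hβ.trans_le (min_le_left _ _)) hαγ (hβ.trans_le (min_le_right _ _)) hαβ
  refine aas_of_tendsto_measureReal_and (hR.densable.2 _ (Ioi_mem_nhds hγd))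
    (squeeze_zero' (Eventually.of_forall fun _ => measureReal_nonneg) ?_ hlim)
  filter_upwards [(tendsto_card_relatorBall hm).eventually_ge_atTop 2] with ℓ hℓ
  exact measureReal_mono (fun ω hω => ⟨not_not.1 hω.1,
    rpow_le_ncard_of_lt_subsetDensity (by exact_mod_cast hℓ) hω.2⟩) (measure_ne_top _ _)

end AsymptoticallyAlmostSurely

theorem mainTheorem7 {Ω : ℕ → Type*} [∀ ℓ, MeasurableSpace (Ω ℓ)]
    (P : ∀ ℓ, Measure (Ω ℓ)) [∀ ℓ, IsProbabilityMeasure (P ℓ)]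
    (m : ℕ) (hm : 2 ≤ m) (p : ℕ) (hp : 1 ≤ p) (d : EReal)
    (R : ∀ ℓ, Ω ℓ → Set (relatorBall m ℓ)) (hR : IsRandomGroupSequence m d P R) :
    (d < ((1 / (2 * (p : ℝ) + 2) : ℝ) : EReal) →
      AAS P (fun ℓ ω => SatisfiesB p (Subtype.val '' R ℓ ω)) ∧
      AAS P (fun ℓ ω => SatisfiesWeakB p (Subtype.val '' R ℓ ω))) ∧
    (((1 / (2 * (p : ℝ) + 2) : ℝ) : EReal) < d →
      AAS P (fun ℓ ω => ¬ SatisfiesB p (Subtype.val '' R ℓ ω)) ∧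
      AAS P (fun ℓ ω => ¬ SatisfiesWeakB p (Subtype.val '' R ℓ ω))) := by
  constructor
  · intro hd
    have h := hR.aas_satisfiesB hm hd
    exact ⟨h, h.mono fun _ _ hB => hB.satisfiesWeakB⟩
  · intro hd
    have h := hR.aas_not_satisfiesWeakB hm hp hd
    exact ⟨h.mono fun _ _ hW hB => hW hB.satisfiesWeakB, h⟩
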